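/- Let $\mathbb K$ be a field of characteristic $0$, let $A$ be a finitely generated semi-free commutative dg-algebra over $\mathbb K$ (cohomologically $\mathbb Z$-graded, underlying graded algebra free graded commutative on finitely many homogeneous generators), and let $\pi=\sum_{k\ge2}\pi^{(k)}$, $\pi^{(k)}\in \mathrm{Sym}^k_A(\mathsf T_A[-3])^{4}$, be a $2$-shifted Poisson structure on $A$, i.e. a solution of the Maurer–Cartan equation $\mathrm d\pi+\tfrac12[\pi,\pi]=0$ for the Schouten–Nijenhuis bracket. Let $\mathbf C=\mathsf{Ho}_2({}_A\mathbf{dgMod}^{\mathrm{sf}})$ be the homotopy $2$-category of finitely generated semi-free $A$-dg-modules (with chosen homogeneous bases): the hom complex $\mathbf C[M,N]$ has the closed $A$-linear maps of degree $0$ in degree $0$ and the $A$-linear maps of degree $-1$ modulo coboundaries in degree $-1$. It is symmetric monoidal with $\otimes=\otimes_A$, unit $A$ and the Koszul braiding $\gamma$. An infinitesimal $2$-braiding is a pseudonatural endomorphism $t:\otimes\Rightarrow\otimes:\mathbf C\boxtimes\mathbf C\to\mathbf C$, with cochain components $t_{UV}\in\mathbf C[U\otimes V,U\otimes V]^0$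 and homotopy components $t_{f\boxtimes g}\in\mathbf C[U\otimes V,U'\otimes V']^{-1}$ for $f\in\mathbf C[U,U']^0$, $g\in\mathbf C[V,V']^0$. It is *symmetric* if $\gamma_{UV}t_{UV}=t_{VU}\gamma_{UV}$ and $\gamma_{U'V'}t_{f\boxtimes g}=t_{g\boxtimes f}\gamma_{UV}$ for all objects and all $f,g$ as above; *totally symmetric* if it is symmetric and $t_{\gamma_{UV}\boxtimes 1_W}=0$ for all $U,V,W$; and *Breen* if $\gamma_{U(WV)}\,t_{1_U\boxtimes\gamma_{VW}}+\gamma_{(VU)W}\,t_{\gamma_{UV}\boxtimes1_W}=0$ for all $U,V,W$ (associators suppressed). For a homogeneous $A$-linear map $P:M\to M'$ let $\nabla P:M\to\Omega_A[1]\otimes_AM'$ be the $A$-linear map obtained by applying the de Rham differential to the matrix entries of $P$ in the chosen bases. Put $\xi_M=\nabla(\mathrm d_M)$ and $\xi_f=-\nabla f$ for closed $f:M\to M'$ of degree $0$, where $\mathrm d_M$ is represented by its values on the basis. For $A$-linear $X:M\to\Omega_A[1]\otimes_A M'$ and $Y:N\to\Omega_A[1]\otimes_A N'$ write $\iota_\pi(X\otimes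 Y)=(\langle\pi^{(2)},\cdot\rangle\otimes1_{M'\otimes N'})(1\otimes\gamma_{M',\Omega_A[1]}\otimes1)(X\otimes Y)$. Then there is an infinitesimal $2$-braiding $t$ on $(\mathbf C,\otimes_A,A,\gamma)$ *induced by* $\pi$, that is, one with $$t_{MN}=\iota_\pi(\xi_M\otimes\xi_N),\qquad t_{f\boxtimes g}=\big[\iota_\pi\big(\xi_f\otimes(1\otimes g)\xi_N\big)+\iota_\pi\big(\xi_{M'}f\otimes\xi_g\big)\big]$$ for all $M,N$ and all closed degree-$0$ maps $f:M\to M'$, $g:N\to N'$; and every infinitesimal $2$-braiding $t$ induced by $\pi$ is totally symmetric (so in particular $t_{\gamma_{UV}\boxtimes1_W}=0$) and is Breen. -/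

import Mathlib

open scoped TensorProduct

universe u v w x u' v'

section Helpers
variable {R : Type u} [CommRing R]

/-- A bilinear map descends to quotients in its second variable and its values. -/
def quotBilin {X : Type v} {P : Type w} {P' : Type x} [AddCommGroup X] [Module R X]
    [AddCommGroup P] [Module R P] [AddCommGroup P'] [Module R P']
    (S : Submodule R P) (S' : Submodule R P') (β : X →ₗ[R] P →ₗ[R] P')
    (h : ∀ y, ∀ s ∈ S, β y s ∈ S') : X →ₗ[R] (P ⧸ S) →ₗ[R] (P' ⧸ S') :=
  (S.liftQ ((β.compr₂ S'.mkQ).flip) (by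
    intro s hs
    rw [LinearMap.mem_ker]
    ext y
    simpa using h y s hs)).flip

theorem quotBilin_mk {X : Type v} {P : Type w} {P' : Type x} [AddCommGroup X] [Module R X]
    [AddCommGroup P] [Module R P] [AddCommGroup P'] [Module R P']
    (S : Submodule R P) (S' : Submodule R P') (β : X →ₗ[R] P →ₗ[R] P')
    (h : ∀ y, ∀ s ∈ S, β y s ∈ S') (y : X) (p : P) :
    quotBilin S S' β h y (Submodule.Quotient.mk p) = Submodule.Quotient.mk (β y p) := rfl

end Helpers

/-- A category enriched in cochain complexes of `R`-modules concentrated in degrees `-1, 0`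
(with the truncated tensor product): `Hom₀` holds the 1-cells (degree `0`), `Hom₁` the 2-cells
(degree `-1`), and `δ` is the hom differential.  The axiom `exchange` says that composition
respects the truncation. -/
structure CochainTwoCat (R : Type u) [CommRing R] where
  Obj : Type v
  Hom₀ : Obj → Obj → Type w
  Hom₁ : Obj → Obj → Type w
  [acg₀ : ∀ U V, AddCommGroup (Hom₀ U V)]
  [mod₀ : ∀ U V, Module R (Hom₀ U V)]
  [acg₁ : ∀ U V, AddCommGroup (Hom₁ U V)]
  [mod₁ : ∀ U V, Module R (Hom₁ U V)]
  δ : ∀ {U V}, Hom₁ U V →ₗ[R] Hom₀ U V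
  one : ∀ U, Hom₀ U U
  /-- `comp g f = g f` -/
  comp : ∀ {U V W}, Hom₀ V W →ₗ[R] Hom₀ U V →ₗ[R] Hom₀ U W
  /-- `lwh g φ = g φ` for a 1-cell `g` and a 2-cell `φ` -/
  lwh : ∀ {U V W}, Hom₀ V W →ₗ[R] Hom₁ U V →ₗ[R] Hom₁ U W
  /-- `rwh f φ = φ f` for a 1-cell `f` and a 2-cell `φ` -/
  rwh : ∀ {U V W}, Hom₀ U V →ₗ[R] Hom₁ V W →ₗ[R] Hom₁ U W
  one_comp : ∀ {U V} (f : Hom₀ U V), comp (one V) f = f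
  comp_one : ∀ {U V} (f : Hom₀ U V), comp f (one U) = f
  one_lwh : ∀ {U V} (φ : Hom₁ U V), lwh (one V) φ = φ
  one_rwh : ∀ {U V} (φ : Hom₁ U V), rwh (one U) φ = φ
  comp_assoc : ∀ {U V W X} (h : Hom₀ W X) (g : Hom₀ V W) (f : Hom₀ U V),
    comp (comp h g) f = comp h (comp g f)
  comp_lwh : ∀ {U V W X} (h : Hom₀ W X) (g : Hom₀ V W) (φ : Hom₁ U V),
    lwh (comp h g) φ = lwh h (lwh g φ)
  comp_rwh : ∀ {U V W X} (φ : Hom₁ W X) (g : Hom₀ V W) (f : Hom₀ U V),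
    rwh (comp g f) φ = rwh f (rwh g φ)
  lwh_rwh : ∀ {U V W X} (h : Hom₀ W X) (φ : Hom₁ V W) (f : Hom₀ U V),
    rwh f (lwh h φ) = lwh h (rwh f φ)
  δ_lwh : ∀ {U V W} (g : Hom₀ V W) (φ : Hom₁ U V), δ (lwh g φ) = comp g (δ φ)
  δ_rwh : ∀ {U V W} (φ : Hom₁ V W) (f : Hom₀ U V), δ (rwh f φ) = comp (δ φ) f
  exchange : ∀ {U V W} (ψ : Hom₁ V W) (φ : Hom₁ U V), lwh (δ ψ) φ = rwh (δ φ) ψ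

attribute [instance] CochainTwoCat.acg₀ CochainTwoCat.mod₀ CochainTwoCat.acg₁ CochainTwoCat.mod₁

namespace CochainTwoCat

variable {R : Type u} [CommRing R]

/-- Enriched functors. -/
structure Fun (C : CochainTwoCat.{u, v, w} R) (D : CochainTwoCat.{u, v', x} R) where
  obj : C.Obj → D.Obj
  map₀ : ∀ {U V}, C.Hom₀ U V →ₗ[R] D.Hom₀ (obj U) (obj V)
  map₁ : ∀ {U V}, C.Hom₁ U V →ₗ[R] D.Hom₁ (obj U) (obj V)
  map_δ : ∀ {U V} (φ : C.Hom₁ U V), map₀ (C.δ φ) = D.δ (map₁ φ)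
  map_one : ∀ U, map₀ (C.one U) = D.one (obj U)
  map_comp : ∀ {U V W} (g : C.Hom₀ V W) (f : C.Hom₀ U V),
    map₀ (C.comp g f) = D.comp (map₀ g) (map₀ f)
  map_lwh : ∀ {U V W} (g : C.Hom₀ V W) (φ : C.Hom₁ U V),
    map₁ (C.lwh g φ) = D.lwh (map₀ g) (map₁ φ)
  map_rwh : ∀ {U V W} (f : C.Hom₀ U V) (φ : C.Hom₁ V W),
    map₁ (C.rwh f φ) = D.rwh (map₀ f) (map₁ φ)

/-- Pseudonatural transformations `F ⇒ G`: cochain components `app U` and homotopy components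
`hmt f`. -/
structure PseudoNat {C : CochainTwoCat.{u, v, w} R} {D : CochainTwoCat.{u, v', x} R}
    (F G : Fun C D) where
  app : ∀ U, D.Hom₀ (F.obj U) (G.obj U)
  hmt : ∀ {U U'}, C.Hom₀ U U' →ₗ[R] D.Hom₁ (F.obj U) (G.obj U')
  naturality : ∀ {U U'} (f : C.Hom₀ U U'),
    D.comp (G.map₀ f) (app U) - D.comp (app U') (F.map₀ f) = D.δ (hmt f)
  naturality₁ : ∀ {U U'} (q : C.Hom₁ U U'),
    D.rwh (app U) (G.map₁ q) - D.lwh (app U') (F.map₁ q) = hmt (C.δ q)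
  hmt_one : ∀ U, hmt (C.one U) = 0
  hmt_comp : ∀ {U U' U''} (f' : C.Hom₀ U' U'') (f : C.Hom₀ U U'),
    hmt (C.comp f' f) = D.rwh (F.map₀ f) (hmt f') + D.lwh (G.map₀ f') (hmt f)

section Box

variable (C : CochainTwoCat.{u, v, w} R) (D : CochainTwoCat.{u, v', x} R)

/-- Degree `-1` part of the (untruncated) tensor product of two hom complexes. -/
abbrev BoxPre (U U' : C.Obj) (V V' : D.Obj) : Type _ :=
  (C.Hom₁ U U' ⊗[R] D.Hom₀ V V') × (C.Hom₀ U U' ⊗[R] D.Hom₁ V V')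

/-- The differential `φ ⊗ ψ ↦ δφ ⊗ ψ - φ ⊗ δψ` out of degree `-2`. -/
noncomputable def boxRel (U U' : C.Obj) (V V' : D.Obj) :
    (C.Hom₁ U U' ⊗[R] D.Hom₁ V V') →ₗ[R] BoxPre C D U U' V V' :=
  LinearMap.prod (TensorProduct.map (-(LinearMap.id : C.Hom₁ U U' →ₗ[R] C.Hom₁ U U')) D.δ)
    (TensorProduct.map C.δ LinearMap.id)

/-- 2-cells of the product: degree `-1` of the truncated tensor product. -/
abbrev BoxHom₁ (U U' : C.Obj) (V V' : D.Obj) : Type _ :=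
  BoxPre C D U U' V V' ⧸ LinearMap.range (boxRel C D U U' V V')

variable {C D}

/-- The 2-cell `φ ⊠ g`. -/
noncomputable def boxL {U U' : C.Obj} {V V' : D.Obj} (φ : C.Hom₁ U U') (g : D.Hom₀ V V') :
    BoxHom₁ C D U U' V V' :=
  Submodule.Quotient.mk (φ ⊗ₜ[R] g, 0)

/-- The 2-cell `f ⊠ ψ`. -/
noncomputable def boxR {U U' : C.Obj} {V V' : D.Obj} (f : C.Hom₀ U U') (ψ : D.Hom₁ V V') :
    BoxHom₁ C D U U' V V' :=
  Submodule.Quotient.mk (0, f ⊗ₜ[R] ψ)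

theorem boxHom₁_induction {U U' : C.Obj} {V V' : D.Obj} {p : BoxHom₁ C D U U' V V' → Prop}
    (hl : ∀ φ g, p (boxL φ g)) (hr : ∀ f ψ, p (boxR f ψ)) (ha : ∀ a b, p a → p b → p (a + b))
    (q : BoxHom₁ C D U U' V V') : p q := by
  obtain ⟨⟨a, b⟩, rfl⟩ := Submodule.Quotient.mk_surjective _ q
  have h0 : p 0 := by
    have := hl (0 : C.Hom₁ U U') (0 : D.Hom₀ V V')
    rwa [boxL, TensorProduct.zero_tmul, Prod.mk_zero_zero, Submodule.Quotient.mk_zero] at this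
  have e : (Submodule.Quotient.mk (a, b) : BoxHom₁ C D U U' V V')
      = Submodule.Quotient.mk (a, 0) + Submodule.Quotient.mk (0, b) := by
    rw [← Submodule.Quotient.mk_add]; simp
  rw [e]
  refine ha _ _ ?_ ?_
  · induction a using TensorProduct.induction_on with
    | zero => exact h0
    | tmul φ g => exact hl φ g
    | add s t hs ht =>
      have : (Submodule.Quotient.mk (s + t, 0) : BoxHom₁ C D U U' V V')
        = Submodule.Quotient.mk (s, 0) + Submodule.Quotient.mk (t, 0) := by
        rw [← Submodule.Quotient.mk_add]; simp
      rw [this]; exact ha _ _ (hs (by rw [← Submodule.Quotient.mk_add]; simp))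
        (ht (by rw [← Submodule.Quotient.mk_add]; simp))
  · induction b using TensorProduct.induction_on with
    | zero => exact h0
    | tmul φ g => exact hr φ g
    | add s t hs ht =>
      have : (Submodule.Quotient.mk (0, s + t) : BoxHom₁ C D U U' V V')
        = Submodule.Quotient.mk (0, s) + Submodule.Quotient.mk (0, t) := by
        rw [← Submodule.Quotient.mk_add]; simp
      rw [this]; exact ha _ _ (hs (by rw [← Submodule.Quotient.mk_add]; simp))
        (ht (by rw [← Submodule.Quotient.mk_add]; simp))

theorem boxL_δ {U U' : C.Obj} {V V' : D.Obj} (φ : C.Hom₁ U U') (ψ : D.Hom₁ V V') :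
    boxL φ (D.δ ψ) = boxR (C.δ φ) ψ := by
  symm
  rw [boxL, boxR, Submodule.Quotient.eq]
  exact ⟨φ ⊗ₜ ψ, by simp [boxRel, TensorProduct.neg_tmul]⟩

/-- Differential of the product. -/
noncomputable def boxδ {U U' : C.Obj} {V V' : D.Obj} :
    BoxHom₁ C D U U' V V' →ₗ[R] C.Hom₀ U U' ⊗[R] D.Hom₀ V V' :=
  (LinearMap.range (boxRel C D U U' V V')).liftQ
    (LinearMap.coprod (TensorProduct.map C.δ LinearMap.id) (TensorProduct.map LinearMap.id D.δ)) (by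
      rintro _ ⟨a, rfl⟩
      rw [LinearMap.mem_ker]
      induction a using TensorProduct.induction_on with
      | zero => simp
      | tmul φ ψ => simp [boxRel, TensorProduct.neg_tmul]
      | add s t hs ht => rw [map_add, map_add, hs, ht, add_zero])

theorem boxδ_boxL {U U' : C.Obj} {V V' : D.Obj} (φ : C.Hom₁ U U') (g : D.Hom₀ V V') :
    boxδ (boxL φ g) = C.δ φ ⊗ₜ[R] g := by
  simp [boxδ, boxL]

theorem boxδ_boxR {U U' : C.Obj} {V V' : D.Obj} (f : C.Hom₀ U U') (ψ : D.Hom₁ V V') :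
    boxδ (boxR f ψ) = f ⊗ₜ[R] D.δ ψ := by
  simp [boxδ, boxR]

/-- `(f' ⊠ g') (f ⊠ g) = f' f ⊠ g' g` on 1-cells and 2-cells. -/
noncomputable def boxLwh {U U' U'' : C.Obj} {V V' V'' : D.Obj} :
    (C.Hom₀ U' U'' ⊗[R] D.Hom₀ V' V'') →ₗ[R] BoxHom₁ C D U U' V V' →ₗ[R]
      BoxHom₁ C D U U'' V V'' :=
  quotBilin _ _
    (LinearMap.prodMapLinear R _ _ _ _ R ∘ₗ
      LinearMap.prod (TensorProduct.map₂ C.lwh D.comp) (TensorProduct.map₂ C.comp D.lwh)) (by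
    rintro y _ ⟨a, rfl⟩
    induction y using TensorProduct.induction_on with
    | zero => simp
    | add s t hs ht => rw [map_add, LinearMap.add_apply]; exact add_mem hs ht
    | tmul f g =>
      induction a using TensorProduct.induction_on with
      | zero => rw [map_zero, map_zero]; exact zero_mem _
      | add s t hs ht => rw [map_add, map_add]; exact add_mem hs ht
      | tmul φ ψ => exact ⟨C.lwh f φ ⊗ₜ D.lwh g ψ, by simp [boxRel, TensorProduct.neg_tmul, C.δ_lwh, D.δ_lwh]⟩)

/-- `(f' ⊠ g') (f ⊠ g) = f' f ⊠ g' g` on 2-cells and 1-cells. -/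
noncomputable def boxRwh {U U' U'' : C.Obj} {V V' V'' : D.Obj} :
    (C.Hom₀ U U' ⊗[R] D.Hom₀ V V') →ₗ[R] BoxHom₁ C D U' U'' V' V'' →ₗ[R]
      BoxHom₁ C D U U'' V V'' :=
  quotBilin _ _
    (LinearMap.prodMapLinear R _ _ _ _ R ∘ₗ
      LinearMap.prod (TensorProduct.map₂ C.rwh D.comp.flip)
        (TensorProduct.map₂ C.comp.flip D.rwh)) (by
    rintro y _ ⟨a, rfl⟩
    induction y using TensorProduct.induction_on with
    | zero => simp
    | add s t hs ht => rw [map_add, LinearMap.add_apply]; exact add_mem hs ht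
    | tmul f g =>
      induction a using TensorProduct.induction_on with
      | zero => rw [map_zero, map_zero]; exact zero_mem _
      | add s t hs ht => rw [map_add, map_add]; exact add_mem hs ht
      | tmul φ ψ => exact ⟨C.rwh f φ ⊗ₜ D.rwh g ψ, by simp [boxRel, TensorProduct.neg_tmul, C.δ_rwh, D.δ_rwh]⟩)

section
variable {U U' U'' : C.Obj} {V V' V'' : D.Obj}

theorem boxLwh_boxL (f : C.Hom₀ U' U'') (g : D.Hom₀ V' V'') (φ : C.Hom₁ U U') (k : D.Hom₀ V V') :
    boxLwh (f ⊗ₜ[R] g) (boxL φ k) = boxL (C.lwh f φ) (D.comp g k) := by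
  simp [boxLwh, boxL, quotBilin_mk]

theorem boxLwh_boxR (f : C.Hom₀ U' U'') (g : D.Hom₀ V' V'') (k : C.Hom₀ U U') (ψ : D.Hom₁ V V') :
    boxLwh (f ⊗ₜ[R] g) (boxR k ψ) = boxR (C.comp f k) (D.lwh g ψ) := by
  simp [boxLwh, boxR, quotBilin_mk]

theorem boxRwh_boxL (f : C.Hom₀ U U') (g : D.Hom₀ V V') (φ : C.Hom₁ U' U'') (k : D.Hom₀ V' V'') :
    boxRwh (f ⊗ₜ[R] g) (boxL φ k) = boxL (C.rwh f φ) (D.comp k g) := by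
  simp [boxRwh, boxL, quotBilin_mk]

theorem boxRwh_boxR (f : C.Hom₀ U U') (g : D.Hom₀ V V') (k : C.Hom₀ U' U'') (ψ : D.Hom₁ V' V'') :
    boxRwh (f ⊗ₜ[R] g) (boxR k ψ) = boxR (C.comp k f) (D.rwh g ψ) := by
  simp [boxRwh, boxR, quotBilin_mk]

end

variable (C D)

/-- The product `C ⊠ D`: pairs of objects, and truncated tensor products of hom complexes. -/
@[reducible] noncomputable def box : CochainTwoCat R where
  Obj := C.Obj × D.Obj
  Hom₀ X Y := C.Hom₀ X.1 Y.1 ⊗[R] D.Hom₀ X.2 Y.2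
  Hom₁ X Y := BoxHom₁ C D X.1 Y.1 X.2 Y.2
  δ := boxδ
  one X := C.one X.1 ⊗ₜ D.one X.2
  comp := TensorProduct.map₂ C.comp D.comp
  lwh := boxLwh
  rwh := boxRwh
  one_comp f := by
    induction f using TensorProduct.induction_on with
    | zero => simp
    | add s t hs ht => rw [map_add, hs, ht]
    | tmul f g => simp [C.one_comp, D.one_comp]
  comp_one f := by
    induction f using TensorProduct.induction_on with
    | zero => simp
    | add s t hs ht => rw [map_add, LinearMap.add_apply, hs, ht]
    | tmul f g => simp [C.comp_one, D.comp_one]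
  one_lwh q := by
    induction q using boxHom₁_induction with
    | hl φ g => rw [boxLwh_boxL, C.one_lwh, D.one_comp]
    | hr f ψ => rw [boxLwh_boxR, D.one_lwh, C.one_comp]
    | ha a b ha hb => rw [map_add, ha, hb]
  one_rwh q := by
    induction q using boxHom₁_induction with
    | hl φ g => rw [boxRwh_boxL, C.one_rwh, D.comp_one]
    | hr f ψ => rw [boxRwh_boxR, D.one_rwh, C.comp_one]
    | ha a b ha hb => rw [map_add, ha, hb]
  comp_assoc h g f := by
    induction h using TensorProduct.induction_on with
    | zero => simp
    | add s t hs ht => simp only [map_add, LinearMap.add_apply, hs, ht]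
    | tmul h h' =>
    induction g using TensorProduct.induction_on with
    | zero => simp
    | add s t hs ht => simp only [map_add, LinearMap.add_apply, hs, ht]
    | tmul g g' =>
    induction f using TensorProduct.induction_on with
    | zero => simp
    | add s t hs ht => simp only [map_add, hs, ht]
    | tmul f f' => simp [C.comp_assoc, D.comp_assoc]
  comp_lwh h g q := by
    induction h using TensorProduct.induction_on with
    | zero => simp
    | add s t hs ht => simp only [map_add, LinearMap.add_apply, hs, ht]
    | tmul h h' =>
    induction g using TensorProduct.induction_on with
    | zero => simp
    | add s t hs ht => simp only [map_add, LinearMap.add_apply, hs, ht]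
    | tmul g g' =>
    induction q using boxHom₁_induction with
    | hl φ k => simp [boxLwh_boxL, C.comp_lwh, D.comp_assoc]
    | hr k ψ => simp [boxLwh_boxR, D.comp_lwh, C.comp_assoc]
    | ha a b ha hb => simp only [map_add, ha, hb]
  comp_rwh q h g := by
    induction h using TensorProduct.induction_on with
    | zero => simp
    | add s t hs ht => simp only [map_add, LinearMap.add_apply, hs, ht]
    | tmul h h' =>
    induction g using TensorProduct.induction_on with
    | zero => simp
    | add s t hs ht => simp only [map_add, LinearMap.add_apply, hs, ht]
    | tmul g g' =>
    induction q using boxHom₁_induction with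
    | hl φ k => simp [boxRwh_boxL, C.comp_rwh, D.comp_assoc]
    | hr k ψ => simp [boxRwh_boxR, D.comp_rwh, C.comp_assoc]
    | ha a b ha hb => simp only [map_add, ha, hb]
  lwh_rwh h q g := by
    induction h using TensorProduct.induction_on with
    | zero => simp
    | add s t hs ht => simp only [map_add, LinearMap.add_apply, hs, ht]
    | tmul h h' =>
    induction g using TensorProduct.induction_on with
    | zero => simp
    | add s t hs ht => simp only [map_add, LinearMap.add_apply, hs, ht]
    | tmul g g' =>
    induction q using boxHom₁_induction with
    | hl φ k => simp [boxRwh_boxL, boxLwh_boxL, C.lwh_rwh, D.comp_assoc]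
    | hr k ψ => simp [boxRwh_boxR, boxLwh_boxR, D.lwh_rwh, C.comp_assoc]
    | ha a b ha hb => simp only [map_add, ha, hb]
  δ_lwh h q := by
    induction h using TensorProduct.induction_on with
    | zero => simp
    | add s t hs ht => simp only [map_add, LinearMap.add_apply, hs, ht]
    | tmul h h' =>
    induction q using boxHom₁_induction with
    | hl φ k => simp [boxLwh_boxL, boxδ_boxL, C.δ_lwh]
    | hr k ψ => simp [boxLwh_boxR, boxδ_boxR, D.δ_lwh]
    | ha a b ha hb => simp only [map_add, ha, hb]
  δ_rwh q h := by
    induction h using TensorProduct.induction_on with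
    | zero => simp
    | add s t hs ht => simp only [map_add, LinearMap.add_apply, hs, ht]
    | tmul h h' =>
    induction q using boxHom₁_induction with
    | hl φ k => simp [boxRwh_boxL, boxδ_boxL, C.δ_rwh]
    | hr k ψ => simp [boxRwh_boxR, boxδ_boxR, D.δ_rwh]
    | ha a b ha hb => simp only [map_add, LinearMap.add_apply, ha, hb]
  exchange p q := by
    induction p using boxHom₁_induction with
    | ha a b ha hb => simp only [map_add, LinearMap.add_apply, ha, hb]
    | hl φ k =>
      induction q using boxHom₁_induction with
      | ha a b ha hb => simp only [map_add, LinearMap.add_apply, ha, hb]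
      | hl φ' k' => simp [boxδ_boxL, boxLwh_boxL, boxRwh_boxL, C.exchange]
      | hr k' ψ =>
        rw [boxδ_boxL, boxδ_boxR, boxLwh_boxR, boxRwh_boxL, ← D.δ_lwh, ← C.δ_rwh, boxL_δ]
    | hr k ψ =>
      induction q using boxHom₁_induction with
      | ha a b ha hb => simp only [map_add, LinearMap.add_apply, ha, hb]
      | hr φ' k' => simp [boxδ_boxR, boxLwh_boxR, boxRwh_boxR, D.exchange]
      | hl φ k' =>
        rw [boxδ_boxL, boxδ_boxR, boxLwh_boxL, boxRwh_boxR, ← C.δ_lwh, ← D.δ_rwh, boxL_δ]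

end Box
end CochainTwoCat

/-- The sign `(-1)^n`. -/
def sgn (n : ℤ) : ℤ := (n.negOnePow : ℤˣ)

theorem sgn_mul (m n : ℤ) : sgn m * sgn n = sgn (m + n) := by
  simp [sgn, Int.negOnePow_add]

theorem sgn_congr {m n : ℤ} (h : (m : ZMod 2) = (n : ZMod 2)) : sgn m = sgn n := by
  have : Even (m - n) := by
    rw [← ZMod.intCast_eq_zero_iff_even]; push_cast; rw [h, sub_self]
  rw [sgn, sgn, Int.negOnePow_eq_iff _ _ |>.mpr this]

theorem sgn_zero : sgn 0 = 1 := by simp [sgn]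
theorem sgn_one : sgn 1 = -1 := by simp [sgn]
theorem sgn_neg_one : sgn (-1) = -1 := by simp [sgn]

theorem sgn_sq (m : ℤ) : sgn m * sgn m = 1 := by
  rw [sgn_mul, ← sgn_zero]; apply sgn_congr; push_cast; generalize (m : ZMod 2) = a; revert a; decide

/-- A commutative differential graded algebra over `K` (cohomological grading over `ℤ`). -/
structure CDGA (K : Type u) [Field K] where
  carrier : Type v
  [ring : Ring carrier]
  [algebra : Algebra K carrier]
  gr : ℤ → Submodule K carrier
  [graded : GradedAlgebra gr]
  comm : ∀ {i j : ℤ} {a b : carrier}, a ∈ gr i → b ∈ gr j → a * b = sgn (i * j) • (b * a)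
  d : carrier →ₗ[K] carrier
  d_mem : ∀ {i : ℤ} {a : carrier}, a ∈ gr i → d a ∈ gr (i + 1)
  leibniz : ∀ {i : ℤ} {a : carrier} (b : carrier), a ∈ gr i →
    d (a * b) = d a * b + sgn i • (a * d b)
  d_d : ∀ a, d (d a) = 0

attribute [instance] CDGA.ring CDGA.algebra CDGA.graded

namespace CDGA
variable {K : Type u} [Field K] (A : CDGA.{u, v} K)

theorem d_one : A.d 1 = 0 := by
  have := A.leibniz (1 : A.carrier) (SetLike.GradedOne.one_mem (A := A.gr))
  simpa [sgn_zero] using this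

theorem gr_cast {i j : ℤ} {a : A.carrier} (h : a ∈ A.gr i) (e : i = j) : a ∈ A.gr j := e ▸ h

theorem gr_sgn {i : ℤ} {a : A.carrier} (n : ℤ) (h : a ∈ A.gr i) : n • a ∈ A.gr i :=
  zsmul_mem h n

theorem gr_mul {i j k : ℤ} {a b : A.carrier} (ha : a ∈ A.gr i) (hb : b ∈ A.gr j) (e : i + j = k) :
    a * b ∈ A.gr k := e ▸ SetLike.GradedMul.mul_mem ha hb

/-- `A` is finitely generated semi-free: there are finitely many homogeneous generators such that
the ordered monomials, with exponents at most one for generators of odd degree, form a `K`-basis,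
i.e. the underlying graded algebra is free graded commutative on these generators. -/
def IsSemiFree : Prop :=
  ∃ (r : ℕ) (e : Fin r → ℤ) (x : Fin r → A.carrier), (∀ i, x i ∈ A.gr (e i)) ∧
    LinearIndependent K (fun m : {m : Fin r → ℕ // ∀ i, Odd (e i) → m i ≤ 1} =>
      (List.ofFn fun i => x i ^ m.1 i).prod) ∧
    Submodule.span K (Set.range fun m : {m : Fin r → ℕ // ∀ i, Odd (e i) → m i ≤ 1} =>
      (List.ofFn fun i => x i ^ m.1 i).prod) = ⊤

end CDGA

/-- A finitely generated semi-free dg-module over `A`, with a homogeneous basis `e i` of degree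
`deg i`.  Coefficients are written on the right of basis elements; the differential is
`d (e i) = ∑ j, e j * D j i`, extended by `d (e i * a) = d (e i) * a + (-1)^{deg i} e i * d a`, and
`D_flat` is `d (d (e i)) = 0`. -/
structure SfMod {K : Type u} [Field K] (A : CDGA.{u, v} K) where
  ι : Type
  [fin : Fintype ι]
  [dec : DecidableEq ι]
  deg : ι → ℤ
  D : Matrix ι ι A.carrier
  D_mem : ∀ i j, D i j ∈ A.gr (deg j + 1 - deg i)
  D_flat : D * D + Matrix.of (fun i j => sgn (deg i) • A.d (D i j)) = 0

attribute [instance] SfMod.fin SfMod.dec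

namespace SfMod
variable {K : Type u} [Field K] {A : CDGA.{u, v} K}

/-- Matrices of `A`-linear maps `M → N`: `f (e i) = ∑ j, e j * f j i`. -/
abbrev Mat (M N : SfMod A) : Type v := Matrix N.ι M.ι A.carrier

/-- `A`-linear maps `M → N` of degree `p`. -/
def homDeg (M N : SfMod A) (p : ℤ) : Submodule K (Mat M N) where
  carrier := {f | ∀ j i, f j i ∈ A.gr (M.deg i + p - N.deg j)}
  add_mem' hf hg j i := add_mem (hf j i) (hg j i)
  zero_mem' _ _ := zero_mem _
  smul_mem' c _ hf j i := Submodule.smul_mem _ c (hf j i)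

/-- The entrywise differential `(-1)^{|e j|} d (f j i)`. -/
def dm (M N : SfMod A) : Mat M N →ₗ[K] Mat M N where
  toFun f := Matrix.of fun j i => sgn (N.deg j) • A.d (f j i)
  map_add' f g := by ext; simp
  map_smul' c f := by ext; simp [smul_comm]

theorem dm_apply (M N : SfMod A) (f : Mat M N) (j i) : dm M N f j i = sgn (N.deg j) • A.d (f j i) :=
  rfl

/-- Composition of maps. -/
def mulBilin (M N P : SfMod A) : Mat N P →ₗ[K] Mat M N →ₗ[K] Mat M P :=
  LinearMap.mk₂ K (fun g f => g * f) (fun _ _ _ => Matrix.add_mul _ _ _)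
    (fun _ _ _ => Matrix.smul_mul _ _ _) (fun _ _ _ => Matrix.mul_add _ _ _)
    (fun _ _ _ => Matrix.mul_smul _ _ _)

/-- The differential `d_N f - (-1)^p f d_M` of the hom complex, on maps of degree `p`. -/
def hd (M N : SfMod A) (p : ℤ) : Mat M N →ₗ[K] Mat M N :=
  mulBilin M N N N.D + dm M N - sgn p • (mulBilin M M N).flip M.D

theorem hd_apply (M N : SfMod A) (p : ℤ) (f : Mat M N) :
    hd M N p f = N.D * f + dm M N f - sgn p • (f * M.D) := rfl

theorem mul_mem {M N P : SfMod A} {p q r : ℤ} {g : Mat N P} {f : Mat M N}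
    (hg : g ∈ homDeg N P q) (hf : f ∈ homDeg M N p) (e : q + p = r) : g * f ∈ homDeg M P r := by
  intro j i
  rw [Matrix.mul_apply]
  exact sum_mem fun k _ => A.gr_mul (hg j k) (hf k i) (by lia)

theorem one_mem (M : SfMod A) : (1 : Mat M M) ∈ homDeg M M 0 := by
  intro j i
  rw [Matrix.one_apply]
  split_ifs with h
  · subst h; exact A.gr_cast SetLike.GradedOne.one_mem (by lia)
  · exact zero_mem _

theorem D_mem' (M : SfMod A) : M.D ∈ homDeg M M 1 := fun j i => M.D_mem j i

theorem dm_D (M : SfMod A) : dm M M M.D = - (M.D * M.D) :=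
  (eq_neg_iff_add_eq_zero.mpr (by rw [add_comm]; exact M.D_flat))

theorem dm_mem {M N : SfMod A} {p : ℤ} {f : Mat M N} (hf : f ∈ homDeg M N p) :
    dm M N f ∈ homDeg M N (p + 1) := fun j i =>
  A.gr_sgn _ (A.gr_cast (A.d_mem (hf j i)) (by lia))

theorem hd_mem {M N : SfMod A} {p r : ℤ} {f : Mat M N} (hf : f ∈ homDeg M N p) (e : p + 1 = r) :
    hd M N p f ∈ homDeg M N r := by
  subst e
  rw [hd_apply]
  refine sub_mem (add_mem (mul_mem N.D_mem' hf (by lia)) (dm_mem hf)) (zsmul_mem ?_ _)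
  exact mul_mem hf M.D_mem' (by lia)

theorem dm_dm {M N : SfMod A} (f : Mat M N) : dm M N (dm M N f) = 0 := by
  ext j i; rw [dm_apply, dm_apply, map_zsmul, A.d_d, smul_zero, smul_zero]; rfl

theorem dm_one (M : SfMod A) : dm M M (1 : Mat M M) = 0 := by
  ext j i
  rw [dm_apply, Matrix.one_apply]
  split_ifs <;> simp [A.d_one]

theorem dm_mul {M N P : SfMod A} {q : ℤ} {g : Mat N P} (f : Mat M N)
    (hg : g ∈ homDeg N P q) : dm M P (g * f) = dm N P g * f + sgn q • (g * dm M N f) := by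
  ext j i
  simp only [dm_apply, Matrix.mul_apply, map_sum, Matrix.add_apply, Matrix.smul_apply,
    Finset.smul_sum, ← Finset.sum_add_distrib]
  refine Finset.sum_congr rfl fun k _ => ?_
  rw [A.leibniz _ (hg j k), smul_add, smul_mul_assoc, mul_smul_comm, smul_smul, smul_smul, sgn_mul,
    sgn_mul]
  congr 2
  apply sgn_congr
  push_cast
  generalize (N.deg k : ZMod 2) = a
  generalize (P.deg j : ZMod 2) = b
  generalize (q : ZMod 2) = c
  revert a b c; decide

theorem hd_mul {M N P : SfMod A} {q p r : ℤ} {g : Mat N P} {f : Mat M N}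
    (hg : g ∈ homDeg N P q) (e : q + p = r) :
    hd M P r (g * f) = hd N P q g * f + sgn q • (g * hd M N p f) := by
  subst e
  simp only [hd_apply, dm_mul f hg, Matrix.add_mul, Matrix.sub_mul, Matrix.mul_add, Matrix.mul_sub,
    Matrix.smul_mul, Matrix.mul_smul, smul_add, smul_sub, smul_smul, sgn_mul, Matrix.mul_assoc]
  abel

theorem hd_hd {M N : SfMod A} {p r : ℤ} {f : Mat M N} (hf : f ∈ homDeg M N p) (e : p + 1 = r) :
    hd M N r (hd M N p f) = 0 := by
  subst e
  simp only [hd_apply, map_add, map_sub, map_zsmul, dm_dm, dm_mul f N.D_mem', dm_mul M.D hf, dm_D,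
    Matrix.add_mul, Matrix.sub_mul, Matrix.mul_add, Matrix.mul_sub, Matrix.smul_mul,
    Matrix.mul_smul, smul_add, smul_sub, smul_smul, sgn_mul, Matrix.mul_assoc, Matrix.mul_neg,
    Matrix.neg_mul, sgn_one]
  have h1 : sgn (p + 1) = - sgn p := by rw [← sgn_mul, sgn_one]; ring
  have h2 : sgn (p + 1 + p) = -1 := by
    rw [← sgn_one]; apply sgn_congr; push_cast; generalize (p : ZMod 2) = a; revert a; decide
  have h4 : sgn (p + (p + 1)) = -1 := by rw [← h2]; congr 1; ring
  have h3 : sgn (p + p) = 1 := by rw [← sgn_mul, sgn_sq]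
  rw [h1, h4, h3]
  simp only [neg_smul, one_smul, smul_neg]
  abel

theorem hd_one (M : SfMod A) : hd M M 0 (1 : Mat M M) = 0 := by
  simp [hd_apply, dm_one, sgn_zero]

/-! Tensor products -/

section Tens

/-- Tensor product of maps of degrees `p` and `q`:
`(f ⊗ g) (m ⊗ n) = (-1)^{q |m|} f m ⊗ g n`, where also
`e j * a ⊗ e l = (-1)^{|a| |e l|} (e j ⊗ e l) * a`. -/
def tens {M M' N N' : SfMod A} (p q : ℤ) : Mat M M' →ₗ[K] Mat N N' →ₗ[K]
    Matrix (M'.ι × N'.ι) (M.ι × N.ι) A.carrier :=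
  LinearMap.mk₂ K (fun f g => Matrix.of fun a b =>
      sgn (q * M.deg b.1 + (p + M.deg b.1 - M'.deg a.1) * N'.deg a.2) • (f a.1 b.1 * g a.2 b.2))
    (fun _ _ _ => by ext; simp [add_mul]) (fun _ _ _ => by ext; simp [smul_comm])
    (fun _ _ _ => by ext; simp [mul_add]) (fun _ _ _ => by ext; simp [smul_comm])

theorem tens_apply {M M' N N' : SfMod A} (p q : ℤ) (f : Mat M M') (g : Mat N N') (a b) :
    tens p q f g a b =
      sgn (q * M.deg b.1 + (p + M.deg b.1 - M'.deg a.1) * N'.deg a.2) •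
        (f a.1 b.1 * g a.2 b.2) := rfl

theorem tens_mul {M M' M'' N N' N'' : SfMod A} (p q p' q' : ℤ) {f' : Mat M' M''} {g' : Mat N' N''}
    {f : Mat M M'} {g : Mat N N'}
    (hg : g' ∈ homDeg N' N'' q') (hf : f ∈ homDeg M M' p) :
    tens p' q' f' g' * tens p q f g = sgn (q' * p) • tens (p' + p) (q' + q) (f' * f) (g' * g) := by
  ext ⟨j, l⟩ ⟨i, k⟩
  simp only [Matrix.mul_apply, Matrix.smul_apply, tens_apply, Fintype.sum_prod_type,
    Finset.sum_mul_sum, Finset.smul_sum]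
  refine Finset.sum_congr rfl fun j' _ => Finset.sum_congr rfl fun l' _ => ?_
  have hc := A.comm (hg l l') (hf j' i)
  have e : f' j j' * g' l l' * (f j' i * g l' k) =
      sgn ((N'.deg l' + q' - N''.deg l) * (M.deg i + p - M'.deg j')) •
        (f' j j' * f j' i * (g' l l' * g l' k)) := by
    rw [mul_assoc, ← mul_assoc (g' l l'), hc]
    simp only [smul_mul_assoc, mul_smul_comm, mul_assoc]
  rw [smul_mul_assoc, mul_smul_comm, e]
  simp only [smul_smul, sgn_mul]
  congr 1
  apply sgn_congr
  push_cast
  generalize (N'.deg l' : ZMod 2) = a1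
  generalize (N''.deg l : ZMod 2) = a2
  generalize (M.deg i : ZMod 2) = a3
  generalize (M'.deg j' : ZMod 2) = a4
  generalize (M''.deg j : ZMod 2) = a5
  generalize (p : ZMod 2) = a6
  generalize (q : ZMod 2) = a7
  generalize (p' : ZMod 2) = a8
  generalize (q' : ZMod 2) = a9
  have h2 : (2 : ZMod 2) = 0 := rfl
  have hs : ∀ a : ZMod 2, a + a = 0 := by decide
  have hn : ∀ a : ZMod 2, -a = a := by decide
  simp only [sub_eq_add_neg, hn]
  ring_nf
  simp [h2]

theorem tens_mem {M M' N N' : SfMod A} {p q : ℤ} {f : Mat M M'} {g : Mat N N'}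
    (hf : f ∈ homDeg M M' p) (hg : g ∈ homDeg N N' q) (a b) :
    tens p q f g a b ∈
      A.gr (M.deg b.1 + N.deg b.2 + (p + q) - (M'.deg a.1 + N'.deg a.2)) :=
  A.gr_sgn _ (A.gr_mul (hf _ _) (hg _ _) (by ring))

theorem tens_one_one (M N : SfMod A) :
    tens 0 0 (1 : Mat M M) (1 : Mat N N) = 1 := by
  ext ⟨j, l⟩ ⟨i, k⟩
  rw [tens_apply]
  by_cases h : j = i
  · by_cases h' : l = k
    · subst h h'; simp [sgn_zero]
    · simp [Matrix.one_apply, h, h']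
  · simp [Matrix.one_apply, h]

theorem tens_dm {M M' N N' : SfMod A} (p q p' q' : ℤ) (f : Mat M M') (g : Mat N N')
    (hf : f ∈ homDeg M M' p) (hp : p + 1 = p') (hq : q + 1 = q') :
    (Matrix.of fun a b => sgn (M'.deg a.1 + N'.deg a.2) • A.d (tens p q f g a b)) =
      tens p' q (dm M M' f) g + sgn p • tens p q' f (dm N N' g) := by
  subst hp hq
  ext ⟨j, l⟩ ⟨i, k⟩
  simp only [Matrix.of_apply, Matrix.add_apply, Matrix.smul_apply, tens_apply, dm_apply, map_zsmul,
    A.leibniz _ (hf j i), smul_add, smul_mul_assoc, mul_smul_comm, smul_smul, sgn_mul]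
  congr 2
  · apply sgn_congr
    push_cast
    generalize (M.deg i : ZMod 2) = a1
    generalize (N'.deg l : ZMod 2) = a2
    generalize (M'.deg j : ZMod 2) = a3
    generalize (p : ZMod 2) = a4
    generalize (q : ZMod 2) = a5
    revert a1 a2 a3 a4 a5
    decide
  · apply sgn_congr
    push_cast
    generalize (M.deg i : ZMod 2) = a1
    generalize (N'.deg l : ZMod 2) = a2
    generalize (M'.deg j : ZMod 2) = a3
    generalize (p : ZMod 2) = a4
    generalize (q : ZMod 2) = a5
    revert a1 a2 a3 a4 a5
    decide

/-- The tensor product `M ⊗_A N`, with differential `d ⊗ 1 + 1 ⊗ d`. -/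
@[reducible] def tensor (M N : SfMod A) : SfMod A where
  ι := M.ι × N.ι
  deg a := M.deg a.1 + N.deg a.2
  D := tens 1 0 M.D (1 : Mat N N) + tens 0 1 (1 : Mat M M) N.D
  D_mem a b := add_mem
    (A.gr_cast (tens_mem M.D_mem' N.one_mem a b) (by ring))
    (A.gr_cast (tens_mem M.one_mem N.D_mem' a b) (by ring))
  D_flat := by
    have e1 := tens_dm 1 0 2 1 M.D (1 : Mat N N) M.D_mem' rfl rfl
    have e2 := tens_dm 0 1 1 2 (1 : Mat M M) N.D M.one_mem rfl rfl
    have e3 : (Matrix.of fun a b : M.ι × N.ι => sgn (M.deg a.1 + N.deg a.2) • A.d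
        ((tens 1 0 M.D (1 : Mat N N) + tens 0 1 (1 : Mat M M) N.D) a b)) =
        (Matrix.of fun a b => sgn (M.deg a.1 + N.deg a.2) • A.d (tens 1 0 M.D (1 : Mat N N) a b)) +
        (Matrix.of fun a b => sgn (M.deg a.1 + N.deg a.2) •
          A.d (tens 0 1 (1 : Mat M M) N.D a b)) := by
      ext a b; simp
    rw [e3, e1, e2, Matrix.add_mul, Matrix.mul_add, Matrix.mul_add,
      tens_mul 1 0 1 0 N.one_mem M.D_mem', tens_mul 0 1 1 0 N.one_mem M.one_mem,
      tens_mul 1 0 0 1 N.D_mem' M.D_mem', tens_mul 0 1 0 1 N.D_mem' M.one_mem,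
      dm_one, dm_one, dm_D, dm_D]
    simp [sgn_zero, sgn_one]
    abel

/-- The tensor product of two maps, between the tensor products. -/
def tmap {M M' N N' : SfMod A} (p q : ℤ) : Mat M M' →ₗ[K] Mat N N' →ₗ[K]
    Mat (tensor M N) (tensor M' N') := tens p q

theorem tmap_mem {M M' N N' : SfMod A} {p q r : ℤ} {f : Mat M M'} {g : Mat N N'}
    (hf : f ∈ homDeg M M' p) (hg : g ∈ homDeg N N' q) (e : p + q = r) :
    tmap p q f g ∈ homDeg (tensor M N) (tensor M' N') r := by
  subst e; exact fun a b => tens_mem hf hg a b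

theorem tmap_mul {M M' M'' N N' N'' : SfMod A} (p q p' q' : ℤ) {f' : Mat M' M''} {g' : Mat N' N''}
    {f : Mat M M'} {g : Mat N N'}
    (hg : g' ∈ homDeg N' N'' q') (hf : f ∈ homDeg M M' p) :
    tmap p' q' f' g' * tmap p q f g = sgn (q' * p) • tmap (p' + p) (q' + q) (f' * f) (g' * g) :=
  tens_mul p q p' q' hg hf

theorem tmap_one (M N : SfMod A) :
    tmap 0 0 (1 : Mat M M) (1 : Mat N N) = (1 : Mat (tensor M N) (tensor M N)) :=
  tens_one_one M N

theorem tensor_D (M N : SfMod A) :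
    (tensor M N).D = tmap 1 0 M.D (1 : Mat N N) + tmap 0 1 (1 : Mat M M) N.D := rfl

theorem hd_tmap {M M' N N' : SfMod A} (p q p' q' r : ℤ) {f : Mat M M'} {g : Mat N N'}
    (hf : f ∈ homDeg M M' p) (hg : g ∈ homDeg N N' q)
    (hp : p + 1 = p') (hq : q + 1 = q') (hr : p + q = r) :
    hd (tensor M N) (tensor M' N') r (tmap p q f g) =
      tmap p' q (hd M M' p f) g + sgn p • tmap p q' f (hd N N' q g) := by
  have hd : dm (tensor M N) (tensor M' N') (tmap p q f g) =
    tmap p' q (dm M M' f) g + sgn p • tmap p q' f (dm N N' g) := tens_dm p q p' q' f g hf hp hq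
  subst hp hq hr
  rw [hd_apply, hd_apply, hd_apply, hd, tensor_D, tensor_D, Matrix.add_mul, Matrix.mul_add,
    tmap_mul _ _ _ _ N'.one_mem hf, tmap_mul _ _ _ _ N'.D_mem' hf,
    tmap_mul _ _ _ _ hg M.D_mem', tmap_mul _ _ _ _ hg M.one_mem]
  simp only [map_add, map_sub, map_zsmul, LinearMap.add_apply, LinearMap.sub_apply,
    LinearMap.smul_apply, Matrix.one_mul, Matrix.mul_one, smul_add, smul_sub, smul_smul, sgn_mul,
    zero_mul, mul_zero, one_mul, mul_one, zero_add, add_zero, sgn_zero, one_smul]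
  rw [add_comm 1 p, add_comm 1 q]
  have h : sgn (p + q + q) = sgn p := by
    apply sgn_congr; push_cast; generalize (p : ZMod 2) = a; generalize (q : ZMod 2) = b
    revert a b; decide
  rw [h]
  abel

end Tens
end SfMod

namespace CochainTwoCat

/-- A functor `C ⊠ D → E` presented by bilinear maps on 1-cells and 2-cells. -/
structure BiFun {R : Type u} [CommRing R] (C : CochainTwoCat.{u, v, w} R)
    (D : CochainTwoCat.{u, v', w} R) (E : CochainTwoCat.{u, u', x} R) where
  obj : C.Obj → D.Obj → E.Obj
  b₀ : ∀ {U U' V V'}, C.Hom₀ U U' →ₗ[R] D.Hom₀ V V' →ₗ[R] E.Hom₀ (obj U V) (obj U' V')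
  bL : ∀ {U U' V V'}, C.Hom₁ U U' →ₗ[R] D.Hom₀ V V' →ₗ[R] E.Hom₁ (obj U V) (obj U' V')
  bR : ∀ {U U' V V'}, C.Hom₀ U U' →ₗ[R] D.Hom₁ V V' →ₗ[R] E.Hom₁ (obj U V) (obj U' V')
  rel : ∀ {U U' V V'} (φ : C.Hom₁ U U') (ψ : D.Hom₁ V V'), bR (C.δ φ) ψ = bL φ (D.δ ψ)
  δL : ∀ {U U' V V'} (φ : C.Hom₁ U U') (g : D.Hom₀ V V'), b₀ (C.δ φ) g = E.δ (bL φ g)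
  δR : ∀ {U U' V V'} (f : C.Hom₀ U U') (ψ : D.Hom₁ V V'), b₀ f (D.δ ψ) = E.δ (bR f ψ)
  one : ∀ U V, b₀ (C.one U) (D.one V) = E.one (obj U V)
  comp : ∀ {U U' U'' V V' V''} (f' : C.Hom₀ U' U'') (g' : D.Hom₀ V' V'') (f : C.Hom₀ U U')
    (g : D.Hom₀ V V'), b₀ (C.comp f' f) (D.comp g' g) = E.comp (b₀ f' g') (b₀ f g)
  lwhL : ∀ {U U' U'' V V' V''} (f' : C.Hom₀ U' U'') (g' : D.Hom₀ V' V'') (φ : C.Hom₁ U U')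
    (g : D.Hom₀ V V'), bL (C.lwh f' φ) (D.comp g' g) = E.lwh (b₀ f' g') (bL φ g)
  lwhR : ∀ {U U' U'' V V' V''} (f' : C.Hom₀ U' U'') (g' : D.Hom₀ V' V'') (f : C.Hom₀ U U')
    (ψ : D.Hom₁ V V'), bR (C.comp f' f) (D.lwh g' ψ) = E.lwh (b₀ f' g') (bR f ψ)
  rwhL : ∀ {U U' U'' V V' V''} (f : C.Hom₀ U U') (g : D.Hom₀ V V') (φ : C.Hom₁ U' U'')
    (g' : D.Hom₀ V' V''), bL (C.rwh f φ) (D.comp g' g) = E.rwh (b₀ f g) (bL φ g')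
  rwhR : ∀ {U U' U'' V V' V''} (f : C.Hom₀ U U') (g : D.Hom₀ V V') (f' : C.Hom₀ U' U'')
    (ψ : D.Hom₁ V' V''), bR (C.comp f' f) (D.rwh g ψ) = E.rwh (b₀ f g) (bR f' ψ)

namespace BiFun
variable {R : Type u} [CommRing R] {C : CochainTwoCat.{u, v, w} R}
    {D : CochainTwoCat.{u, v', w} R} {E : CochainTwoCat.{u, u', x} R} (T : BiFun C D E)

noncomputable def map₁ {U U' : C.Obj} {V V' : D.Obj} :
    BoxHom₁ C D U U' V V' →ₗ[R] E.Hom₁ (T.obj U V) (T.obj U' V') :=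
  (LinearMap.range (boxRel C D U U' V V')).liftQ
    (LinearMap.coprod (TensorProduct.lift T.bL) (TensorProduct.lift T.bR)) (by
    rintro _ ⟨a, rfl⟩
    rw [LinearMap.mem_ker]
    induction a using TensorProduct.induction_on with
    | zero => rw [map_zero, map_zero]
    | add s t hs ht => rw [map_add, map_add, hs, ht, add_zero]
    | tmul φ ψ => simp [boxRel, T.rel])

theorem map₁_boxL {U U' : C.Obj} {V V' : D.Obj} (φ : C.Hom₁ U U') (g : D.Hom₀ V V') :
    T.map₁ (boxL φ g) = T.bL φ g := by simp [map₁, boxL]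

theorem map₁_boxR {U U' : C.Obj} {V V' : D.Obj} (f : C.Hom₀ U U') (ψ : D.Hom₁ V V') :
    T.map₁ (boxR f ψ) = T.bR f ψ := by simp [map₁, boxR]

/-- The functor out of the product. -/
noncomputable def toFun : Fun (box C D) E where
  obj X := T.obj X.1 X.2
  map₀ := TensorProduct.lift T.b₀
  map₁ := T.map₁
  map_δ q := by
    induction q using boxHom₁_induction with
    | hl φ g => exact (congrArg _ (boxδ_boxL φ g)).trans (by
        rw [map₁_boxL, TensorProduct.lift.tmul, T.δL])
    | hr f ψ => exact (congrArg _ (boxδ_boxR f ψ)).trans (by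
        rw [map₁_boxR, TensorProduct.lift.tmul, T.δR])
    | ha a b ha hb => rw [map_add, map_add, map_add, map_add, ha, hb]
  map_one X := T.one X.1 X.2
  map_comp h h' := by
    induction h using TensorProduct.induction_on with
    | zero => simp
    | add s t hs ht => simp only [map_add, LinearMap.add_apply, hs, ht]
    | tmul f' g' =>
    induction h' using TensorProduct.induction_on with
    | zero => simp
    | add s t hs ht => simp only [map_add, hs, ht]
    | tmul f g => exact T.comp f' g' f g
  map_lwh h q := by
    induction h using TensorProduct.induction_on with
    | zero => simp
    | add s t hs ht => simp only [map_add, LinearMap.add_apply, hs, ht]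
    | tmul f' g' =>
    induction q using boxHom₁_induction with
    | hl φ g => exact (congrArg _ (boxLwh_boxL f' g' φ g)).trans (by
        rw [map₁_boxL, map₁_boxL, T.lwhL, TensorProduct.lift.tmul])
    | hr f ψ => exact (congrArg _ (boxLwh_boxR f' g' f ψ)).trans (by
        rw [map₁_boxR, map₁_boxR, T.lwhR, TensorProduct.lift.tmul])
    | ha a b ha hb => simp only [map_add, ha, hb]
  map_rwh h q := by
    induction h using TensorProduct.induction_on with
    | zero => simp
    | add s t hs ht => simp only [map_add, LinearMap.add_apply, hs, ht]
    | tmul f g =>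
    induction q using boxHom₁_induction with
    | hl φ g' => exact (congrArg _ (boxRwh_boxL f g φ g')).trans (by
        rw [map₁_boxL, map₁_boxL, T.rwhL, TensorProduct.lift.tmul])
    | hr f' ψ => exact (congrArg _ (boxRwh_boxR f g f' ψ)).trans (by
        rw [map₁_boxR, map₁_boxR, T.rwhR, TensorProduct.lift.tmul])
    | ha a b ha hb => simp only [map_add, ha, hb]

end BiFun

namespace Fun
variable {R : Type u} [CommRing R] {C : CochainTwoCat.{u, v, w} R} (T : Fun (box C C) C)

/-- `U ⊗ V` -/
abbrev tObj (U V : C.Obj) : C.Obj := T.obj (U, V)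

/-- `f ⊗ g` for 1-cells -/
noncomputable def t₀ {U U' V V' : C.Obj} (f : C.Hom₀ U U') (g : C.Hom₀ V V') :
    C.Hom₀ (T.tObj U V) (T.tObj U' V') :=
  T.map₀ (U := (U, V)) (V := (U', V')) (f ⊗ₜ[R] g)

/-- `φ ⊗ g` for a 2-cell `φ` and a 1-cell `g` -/
noncomputable def tL {U U' V V' : C.Obj} (φ : C.Hom₁ U U') (g : C.Hom₀ V V') :
    C.Hom₁ (T.tObj U V) (T.tObj U' V') :=
  T.map₁ (U := (U, V)) (V := (U', V')) (boxL φ g)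

/-- `f ⊗ ψ` for a 1-cell `f` and a 2-cell `ψ` -/
noncomputable def tR {U U' V V' : C.Obj} (f : C.Hom₀ U U') (ψ : C.Hom₁ V V') :
    C.Hom₁ (T.tObj U V) (T.tObj U' V') :=
  T.map₁ (U := (U, V)) (V := (U', V')) (boxR f ψ)

end Fun

section
variable {R : Type u} [CommRing R] {C : CochainTwoCat.{u, v, w} R} (T : BiFun C C C)
  {U U' V V' : C.Obj}

theorem BiFun.toFun_t₀ (f : C.Hom₀ U U') (g : C.Hom₀ V V') : T.toFun.t₀ f g = T.b₀ f g := rfl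

theorem BiFun.toFun_tL (φ : C.Hom₁ U U') (g : C.Hom₀ V V') : T.toFun.tL φ g = T.bL φ g :=
  T.map₁_boxL φ g

theorem BiFun.toFun_tR (f : C.Hom₀ U U') (ψ : C.Hom₁ V V') : T.toFun.tR f ψ = T.bR f ψ :=
  T.map₁_boxR f ψ
end

/-- A symmetric monoidal category enriched in cochain complexes concentrated in degrees `-1, 0`:
the tensor product is an enriched functor `C ⊠ C → C`, and associator, unitors and symmetric
braiding are natural isomorphisms (natural with respect to 1-cells and 2-cells). -/
structure SymMon (R : Type u) [CommRing R] where
  cat : CochainTwoCat.{u, v, w} R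
  tensor : Fun (box cat cat) cat
  unit : cat.Obj
  α : ∀ U V W, cat.Hom₀ (tensor.tObj (tensor.tObj U V) W) (tensor.tObj U (tensor.tObj V W))
  αinv : ∀ U V W, cat.Hom₀ (tensor.tObj U (tensor.tObj V W)) (tensor.tObj (tensor.tObj U V) W)
  lu : ∀ U, cat.Hom₀ (tensor.tObj unit U) U
  luinv : ∀ U, cat.Hom₀ U (tensor.tObj unit U)
  ru : ∀ U, cat.Hom₀ (tensor.tObj U unit) U
  ruinv : ∀ U, cat.Hom₀ U (tensor.tObj U unit)
  γ : ∀ U V, cat.Hom₀ (tensor.tObj U V) (tensor.tObj V U)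
  α_αinv : ∀ U V W, cat.comp (α U V W) (αinv U V W) = cat.one _
  αinv_α : ∀ U V W, cat.comp (αinv U V W) (α U V W) = cat.one _
  lu_luinv : ∀ U, cat.comp (lu U) (luinv U) = cat.one _
  luinv_lu : ∀ U, cat.comp (luinv U) (lu U) = cat.one _
  ru_ruinv : ∀ U, cat.comp (ru U) (ruinv U) = cat.one _
  ruinv_ru : ∀ U, cat.comp (ruinv U) (ru U) = cat.one _
  γ_γ : ∀ U V, cat.comp (γ V U) (γ U V) = cat.one _
  α_nat : ∀ {U U' V V' W W'} (f : cat.Hom₀ U U') (g : cat.Hom₀ V V') (k : cat.Hom₀ W W'),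
    cat.comp (α U' V' W') (tensor.t₀ (tensor.t₀ f g) k) =
      cat.comp (tensor.t₀ f (tensor.t₀ g k)) (α U V W)
  α_nat₁ : ∀ {U U' V V' W W'} (φ : cat.Hom₁ U U') (g : cat.Hom₀ V V') (k : cat.Hom₀ W W'),
    cat.lwh (α U' V' W') (tensor.tL (tensor.tL φ g) k) =
      cat.rwh (α U V W) (tensor.tL φ (tensor.t₀ g k))
  α_nat₂ : ∀ {U U' V V' W W'} (f : cat.Hom₀ U U') (φ : cat.Hom₁ V V') (k : cat.Hom₀ W W'),
    cat.lwh (α U' V' W') (tensor.tL (tensor.tR f φ) k) =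
      cat.rwh (α U V W) (tensor.tR f (tensor.tL φ k))
  α_nat₃ : ∀ {U U' V V' W W'} (f : cat.Hom₀ U U') (g : cat.Hom₀ V V') (φ : cat.Hom₁ W W'),
    cat.lwh (α U' V' W') (tensor.tR (tensor.t₀ f g) φ) =
      cat.rwh (α U V W) (tensor.tR f (tensor.tR g φ))
  lu_nat : ∀ {U U'} (f : cat.Hom₀ U U'),
    cat.comp (lu U') (tensor.t₀ (cat.one unit) f) = cat.comp f (lu U)
  lu_nat₁ : ∀ {U U'} (φ : cat.Hom₁ U U'),
    cat.lwh (lu U') (tensor.tR (cat.one unit) φ) = cat.rwh (lu U) φ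
  ru_nat : ∀ {U U'} (f : cat.Hom₀ U U'),
    cat.comp (ru U') (tensor.t₀ f (cat.one unit)) = cat.comp f (ru U)
  ru_nat₁ : ∀ {U U'} (φ : cat.Hom₁ U U'),
    cat.lwh (ru U') (tensor.tL φ (cat.one unit)) = cat.rwh (ru U) φ
  γ_nat : ∀ {U U' V V'} (f : cat.Hom₀ U U') (g : cat.Hom₀ V V'),
    cat.comp (γ U' V') (tensor.t₀ f g) = cat.comp (tensor.t₀ g f) (γ U V)
  γ_nat₁ : ∀ {U U' V V'} (φ : cat.Hom₁ U U') (g : cat.Hom₀ V V'),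
    cat.lwh (γ U' V') (tensor.tL φ g) = cat.rwh (γ U V) (tensor.tR g φ)
  γ_nat₂ : ∀ {U U' V V'} (f : cat.Hom₀ U U') (φ : cat.Hom₁ V V'),
    cat.lwh (γ U' V') (tensor.tR f φ) = cat.rwh (γ U V) (tensor.tL φ f)
  pentagon : ∀ U V W X,
    cat.comp (tensor.t₀ (cat.one U) (α V W X))
      (cat.comp (α U (tensor.tObj V W) X) (tensor.t₀ (α U V W) (cat.one X))) =
    cat.comp (α U V (tensor.tObj W X)) (α (tensor.tObj U V) W X)
  triangle : ∀ U V,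
    cat.comp (tensor.t₀ (cat.one U) (lu V)) (α U unit V) = tensor.t₀ (ru U) (cat.one V)
  hexagon : ∀ U V W,
    cat.comp (α V W U) (cat.comp (γ U (tensor.tObj V W)) (α U V W)) =
    cat.comp (tensor.t₀ (cat.one V) (γ U W))
      (cat.comp (α V U W) (tensor.t₀ (γ U V) (cat.one W)))
end CochainTwoCat

namespace SfMod
variable {K : Type u} [Field K] {A : CDGA.{u, v} K}

/-- The 1-cells `M ⟶ N`: closed maps of degree `0`. -/
def Z0 (M N : SfMod A) : Submodule K (Mat M N) := homDeg M N 0 ⊓ LinearMap.ker (hd M N 0)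

/-- Coboundaries in degree `-1`. -/
def bd (M N : SfMod A) : Submodule K (homDeg M N (-1)) :=
  ((homDeg M N (-2)).map (hd M N (-2))).comap (homDeg M N (-1)).subtype

/-- The 2-cells: maps of degree `-1` modulo coboundaries of maps of degree `-2`. -/
abbrev H1 (M N : SfMod A) : Type v := homDeg M N (-1) ⧸ bd M N

theorem z0_mem {M N : SfMod A} (f : Z0 M N) : f.1 ∈ homDeg M N 0 := f.2.1
theorem z0_hd {M N : SfMod A} (f : Z0 M N) : SfMod.hd M N 0 f.1 = 0 := f.2.2

def H1.mk {M N : SfMod A} (φ : homDeg M N (-1)) : H1 M N := Submodule.Quotient.mk φ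

theorem H1.mk_eq {M N : SfMod A} {φ ψ : homDeg M N (-1)} (h : φ.1 = ψ.1) : H1.mk φ = H1.mk ψ :=
  congrArg _ (Subtype.ext h)

theorem H1.ind {M N : SfMod A} {p : H1 M N → Prop} (h : ∀ φ, p (H1.mk φ)) (q : H1 M N) : p q := by
  obtain ⟨φ, rfl⟩ := Submodule.Quotient.mk_surjective _ q
  exact h φ

theorem mem_bd {M N : SfMod A} {φ : homDeg M N (-1)} :
    φ ∈ bd M N ↔ ∃ χ ∈ homDeg M N (-2), SfMod.hd M N (-2) χ = φ.1 := Iff.rfl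

def δ (M N : SfMod A) : H1 M N →ₗ[K] Z0 M N :=
  (bd M N).liftQ
    { toFun := fun φ => ⟨hd M N (-1) φ.1, hd_mem φ.2 (by lia), hd_hd φ.2 (by lia)⟩
      map_add' := fun _ _ => Subtype.ext (map_add _ _ _)
      map_smul' := fun _ _ => Subtype.ext (map_smul _ _ _) } (by
    rintro φ ⟨χ, hχ, e⟩
    rw [LinearMap.mem_ker]
    refine Subtype.ext ?_
    change hd M N (-1) φ.1 = 0
    rw [← show hd M N (-2) χ = φ.1 from e]
    exact hd_hd hχ (by lia))

theorem δ_mk {M N : SfMod A} (φ : homDeg M N (-1)) : (δ M N (H1.mk φ)).1 = hd M N (-1) φ.1 := rfl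

def comp (M N P : SfMod A) : Z0 N P →ₗ[K] Z0 M N →ₗ[K] Z0 M P :=
  LinearMap.mk₂ K (fun g f => ⟨g.1 * f.1, mul_mem (z0_mem g) (z0_mem f) (by lia), by
      rw [SetLike.mem_coe, LinearMap.mem_ker, hd_mul (p := 0) (z0_mem g) (by lia), z0_hd g, z0_hd f]; simp⟩)
    (fun _ _ _ => Subtype.ext (Matrix.add_mul _ _ _))
    (fun _ _ _ => Subtype.ext (Matrix.smul_mul _ _ _))
    (fun _ _ _ => Subtype.ext (Matrix.mul_add _ _ _))
    (fun _ _ _ => Subtype.ext (Matrix.mul_smul _ _ _))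

def lwh (M N P : SfMod A) : Z0 N P →ₗ[K] H1 M N →ₗ[K] H1 M P :=
  quotBilin _ _ (LinearMap.mk₂ K
    (fun g φ => ⟨g.1 * φ.1, mul_mem (z0_mem g) φ.2 (by lia)⟩)
    (fun _ _ _ => Subtype.ext (Matrix.add_mul _ _ _))
    (fun _ _ _ => Subtype.ext (Matrix.smul_mul _ _ _))
    (fun _ _ _ => Subtype.ext (Matrix.mul_add _ _ _))
    (fun _ _ _ => Subtype.ext (Matrix.mul_smul _ _ _))) (by
    rintro g φ ⟨χ, hχ, e⟩
    refine ⟨g.1 * χ, mul_mem (z0_mem g) hχ (by lia), ?_⟩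
    rw [hd_mul (p := -2) (z0_mem g) (by lia), z0_hd g, e]
    simp [sgn_zero])

def rwh (M N P : SfMod A) : Z0 M N →ₗ[K] H1 N P →ₗ[K] H1 M P :=
  quotBilin _ _ (LinearMap.mk₂ K
    (fun f φ => ⟨φ.1 * f.1, mul_mem φ.2 (z0_mem f) (by lia)⟩)
    (fun _ _ _ => Subtype.ext (Matrix.mul_add _ _ _))
    (fun _ _ _ => Subtype.ext (Matrix.mul_smul _ _ _))
    (fun _ _ _ => Subtype.ext (Matrix.add_mul _ _ _))
    (fun _ _ _ => Subtype.ext (Matrix.smul_mul _ _ _))) (by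
    rintro f φ ⟨χ, hχ, e⟩
    refine ⟨χ * f.1, mul_mem hχ (z0_mem f) (by lia), ?_⟩
    rw [hd_mul (p := 0) hχ (by lia), z0_hd f, e]
    simp)

/-- The homotopy 2-category `Ho₂` of the dg-category of f.g. semi-free dg-modules over `A`: hom
complexes are truncated to degrees `-1, 0`. -/
@[reducible] def ho2 (A : CDGA.{u, v} K) : CochainTwoCat K where
  Obj := SfMod A
  Hom₀ M N := Z0 M N
  Hom₁ M N := H1 M N
  δ {M N} := δ M N
  one M := ⟨1, one_mem M, hd_one M⟩
  comp {M N P} := comp M N P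
  lwh {M N P} := lwh M N P
  rwh {M N P} := rwh M N P
  one_comp f := Subtype.ext (Matrix.one_mul _)
  comp_one f := Subtype.ext (Matrix.mul_one _)
  one_lwh φ := by
    induction φ using H1.ind with | h φ => exact H1.mk_eq (Matrix.one_mul _)
  one_rwh φ := by
    induction φ using H1.ind with | h φ => exact H1.mk_eq (Matrix.mul_one _)
  comp_assoc h g f := Subtype.ext (Matrix.mul_assoc _ _ _)
  comp_lwh h g φ := by
    induction φ using H1.ind with | h φ => exact H1.mk_eq (Matrix.mul_assoc _ _ _)
  comp_rwh φ h g := by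
    induction φ using H1.ind with | h φ => exact H1.mk_eq (Matrix.mul_assoc _ _ _).symm
  lwh_rwh h φ g := by
    induction φ using H1.ind with | h φ => exact H1.mk_eq (Matrix.mul_assoc _ _ _)
  δ_lwh g φ := by
    induction φ using H1.ind with
    | h φ =>
      refine Subtype.ext ?_
      change hd _ _ (-1) (g.1 * φ.1) = g.1 * hd _ _ (-1) φ.1
      rw [hd_mul (p := -1) (z0_mem g) (by lia), z0_hd g]
      simp [sgn_zero]
  δ_rwh φ g := by
    induction φ using H1.ind with
    | h φ =>
      refine Subtype.ext ?_
      change hd _ _ (-1) (φ.1 * g.1) = hd _ _ (-1) φ.1 * g.1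
      rw [hd_mul (p := 0) φ.2 (by lia), z0_hd g]
      simp
  exchange ψ φ := by
    induction φ using H1.ind with
    | h φ =>
    induction ψ using H1.ind with
    | h ψ =>
      refine (Submodule.Quotient.eq _).mpr ?_
      refine ⟨ψ.1 * φ.1, mul_mem ψ.2 φ.2 (by lia), ?_⟩
      change hd _ _ (-2) (ψ.1 * φ.1) = hd _ _ (-1) ψ.1 * φ.1 - ψ.1 * hd _ _ (-1) φ.1
      rw [hd_mul (p := -1) ψ.2 (by lia), sgn_neg_one, neg_one_zsmul, sub_eq_add_neg]

def tmap₀ (M M' N N' : SfMod A) :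
    Z0 M M' →ₗ[K] Z0 N N' →ₗ[K] Z0 (tensor M N) (tensor M' N') :=
  LinearMap.mk₂ K
    (fun f g => ⟨tmap 0 0 f.1 g.1, tmap_mem (z0_mem f) (z0_mem g) (by lia), by
      rw [SetLike.mem_coe, LinearMap.mem_ker, hd_tmap 0 0 1 1 0 (z0_mem f) (z0_mem g) rfl rfl rfl, z0_hd f, z0_hd g]; simp⟩)
    (fun _ _ _ => Subtype.ext (LinearMap.map_add₂ _ _ _ _))
    (fun _ _ _ => Subtype.ext (LinearMap.map_smul₂ _ _ _ _))
    (fun _ _ _ => Subtype.ext (map_add _ _ _))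
    (fun _ _ _ => Subtype.ext (map_smul _ _ _))

def tmapL (M M' N N' : SfMod A) :
    Z0 N N' →ₗ[K] H1 M M' →ₗ[K] H1 (tensor M N) (tensor M' N') :=
  quotBilin _ _ (LinearMap.mk₂ K
    (fun g φ => ⟨tmap (-1) 0 φ.1 g.1, tmap_mem φ.2 (z0_mem g) (by lia)⟩)
    (fun _ _ _ => Subtype.ext (map_add _ _ _))
    (fun _ _ _ => Subtype.ext (map_smul _ _ _))
    (fun _ _ _ => Subtype.ext (LinearMap.map_add₂ _ _ _ _))
    (fun _ _ _ => Subtype.ext (LinearMap.map_smul₂ _ _ _ _))) (by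
    rintro g φ ⟨χ, hχ, e⟩
    refine ⟨tmap (-2) 0 χ g.1, tmap_mem hχ (z0_mem g) (by lia), ?_⟩
    rw [hd_tmap (-2) 0 (-1) 1 (-2) hχ (z0_mem g) rfl rfl rfl, z0_hd g, e]
    simp)

def tmapR (M M' N N' : SfMod A) :
    Z0 M M' →ₗ[K] H1 N N' →ₗ[K] H1 (tensor M N) (tensor M' N') :=
  quotBilin _ _ (LinearMap.mk₂ K
    (fun f φ => ⟨tmap 0 (-1) f.1 φ.1, tmap_mem (z0_mem f) φ.2 (by lia)⟩)
    (fun _ _ _ => Subtype.ext (LinearMap.map_add₂ _ _ _ _))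
    (fun _ _ _ => Subtype.ext (LinearMap.map_smul₂ _ _ _ _))
    (fun _ _ _ => Subtype.ext (map_add _ _ _))
    (fun _ _ _ => Subtype.ext (map_smul _ _ _))) (by
    rintro f φ ⟨χ, hχ, e⟩
    refine ⟨tmap 0 (-2) f.1 χ, tmap_mem (z0_mem f) hχ (by lia), ?_⟩
    rw [hd_tmap 0 (-2) 1 (-1) (-2) (z0_mem f) hχ rfl rfl rfl, z0_hd f, e]
    simp [sgn_zero])

/-- The tensor product as bilinear data. -/
def tensorBi (A : CDGA.{u, v} K) : CochainTwoCat.BiFun (ho2 A) (ho2 A) (ho2 A) where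
  obj M N := tensor M N
  b₀ {M M' N N'} := tmap₀ M M' N N'
  bL {M M' N N'} := (tmapL M M' N N').flip
  bR {M M' N N'} := tmapR M M' N N'
  rel φ ψ := by
    induction φ using H1.ind with
    | h φ =>
    induction ψ using H1.ind with
    | h ψ =>
    refine (Submodule.Quotient.eq _).mpr ?_
    refine ⟨tmap (-1) (-1) φ.1 ψ.1, tmap_mem φ.2 ψ.2 (by lia), ?_⟩
    rw [hd_tmap (-1) (-1) 0 0 (-2) φ.2 ψ.2 rfl rfl rfl, sgn_neg_one, neg_one_zsmul,
      ← sub_eq_add_neg]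
    rfl
  δL φ g := by
    induction φ using H1.ind with
    | h φ =>
    refine Subtype.ext ?_
    change tmap 0 0 (hd _ _ (-1) φ.1) g.1 = hd _ _ (-1) (tmap (-1) 0 φ.1 g.1)
    rw [hd_tmap (-1) 0 0 1 (-1) φ.2 (z0_mem g) rfl rfl rfl, z0_hd g]
    simp
  δR f ψ := by
    induction ψ using H1.ind with
    | h ψ =>
    refine Subtype.ext ?_
    change tmap 0 0 f.1 (hd _ _ (-1) ψ.1) = hd _ _ (-1) (tmap 0 (-1) f.1 ψ.1)
    rw [hd_tmap 0 (-1) 1 0 (-1) (z0_mem f) ψ.2 rfl rfl rfl, z0_hd f]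
    simp [sgn_zero]
  one M N := Subtype.ext (tmap_one M N)
  comp f' g' f g := by
    refine Subtype.ext ?_
    change tmap 0 0 (f'.1 * f.1) (g'.1 * g.1) = tmap 0 0 f'.1 g'.1 * tmap 0 0 f.1 g.1
    rw [tmap_mul 0 0 0 0 (z0_mem g') (z0_mem f)]
    simp [sgn_zero]
  lwhL f' g' φ g := by
    induction φ using H1.ind with
    | h φ =>
    refine H1.mk_eq ?_
    change tmap (-1) 0 (f'.1 * φ.1) (g'.1 * g.1) = tmap 0 0 f'.1 g'.1 * tmap (-1) 0 φ.1 g.1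
    rw [tmap_mul (-1) 0 0 0 (z0_mem g') φ.2]
    simp [sgn_zero]
  lwhR f' g' f ψ := by
    induction ψ using H1.ind with
    | h ψ =>
    refine H1.mk_eq ?_
    change tmap 0 (-1) (f'.1 * f.1) (g'.1 * ψ.1) = tmap 0 0 f'.1 g'.1 * tmap 0 (-1) f.1 ψ.1
    rw [tmap_mul 0 (-1) 0 0 (z0_mem g') (z0_mem f)]
    simp [sgn_zero]
  rwhL f g φ g' := by
    induction φ using H1.ind with
    | h φ =>
    refine H1.mk_eq ?_
    change tmap (-1) 0 (φ.1 * f.1) (g'.1 * g.1) = tmap (-1) 0 φ.1 g'.1 * tmap 0 0 f.1 g.1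
    rw [tmap_mul 0 0 (-1) 0 (z0_mem g') (z0_mem f)]
    simp [sgn_zero]
  rwhR f g f' ψ := by
    induction ψ using H1.ind with
    | h ψ =>
    refine H1.mk_eq ?_
    change tmap 0 (-1) (f'.1 * f.1) (ψ.1 * g.1) = tmap 0 (-1) f'.1 ψ.1 * tmap 0 0 f.1 g.1
    rw [tmap_mul 0 0 0 (-1) ψ.2 (z0_mem f)]
    simp [sgn_zero]

/-- The matrix `e i ↦ c i * e (σ i)`. -/
def pm (M N : SfMod A) (σ : M.ι ≃ N.ι) (c : M.ι → ℤ) : Mat M N :=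
  Matrix.of fun j i => if j = σ i then c i • (1 : A.carrier) else 0

section pm
variable {M N P : SfMod A}

theorem mul_pm (σ : M.ι ≃ N.ι) (c : M.ι → ℤ) (X : Mat N P) (j : P.ι) (i : M.ι) :
    (X * pm M N σ c) j i = c i • X j (σ i) := by
  simp only [Matrix.mul_apply, pm, Matrix.of_apply, mul_ite, mul_zero, mul_smul_comm, mul_one,
    Finset.sum_ite_eq', Finset.mem_univ, if_true]

theorem pm_mul (σ : N.ι ≃ P.ι) (c : N.ι → ℤ) (X : Mat M N) (j : P.ι) (i : M.ι) :
    (pm N P σ c * X) j i = c (σ.symm j) • X (σ.symm j) i := by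
  simp only [Matrix.mul_apply, pm, Matrix.of_apply, ite_mul, zero_mul, smul_mul_assoc, one_mul]
  rw [Finset.sum_eq_single (σ.symm j)]
  · simp
  · intro b _ hb
    rw [if_neg]
    rintro rfl
    simp at hb
  · simp

theorem pm_pm (σ : M.ι ≃ N.ι) (c : M.ι → ℤ) (τ : N.ι ≃ P.ι) (c' : N.ι → ℤ) :
    pm N P τ c' * pm M N σ c = pm M P (σ.trans τ) (fun i => c i * c' (σ i)) := by
  ext j i
  rw [mul_pm]
  simp [pm]

theorem pm_one : pm M M (Equiv.refl _) (fun _ => 1) = 1 := by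
  ext j i; simp [pm, Matrix.one_apply]

theorem pm_mem (σ : M.ι ≃ N.ι) (c : M.ι → ℤ) (h : ∀ i, N.deg (σ i) = M.deg i) :
    pm M N σ c ∈ homDeg M N 0 := by
  intro j i
  simp only [pm, Matrix.of_apply]
  split_ifs with e
  · subst e
    exact A.gr_sgn _ (A.gr_cast SetLike.GradedOne.one_mem (by rw [h]; lia))
  · exact zero_mem _

theorem pm_hd (σ : M.ι ≃ N.ι) (c : M.ι → ℤ)
    (h : N.D * pm M N σ c = pm M N σ c * M.D) : hd M N 0 (pm M N σ c) = 0 := by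
  have : dm M N (pm M N σ c) = 0 := by
    ext j i
    simp only [dm_apply, pm, Matrix.of_apply]
    split_ifs <;> simp only [map_zsmul, A.d_one, map_zero, smul_zero, Matrix.zero_apply]
  rw [hd_apply, this, h, sgn_zero]
  simp
end pm


/-- The monoidal unit `A`. -/
@[reducible] def I (A : CDGA.{u, v} K) : SfMod A where
  ι := Unit
  deg _ := 0
  D := 0
  D_mem _ _ := zero_mem _
  D_flat := by ext; simp

def αm (M N P : SfMod A) : Mat (tensor (tensor M N) P) (tensor M (tensor N P)) :=
  pm _ _ (Equiv.prodAssoc M.ι N.ι P.ι) (fun _ => 1)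
def lm (M : SfMod A) : Mat (tensor (I A) M) M := pm _ _ (Equiv.punitProd M.ι) (fun _ => 1)
def rm (M : SfMod A) : Mat (tensor M (I A)) M := pm _ _ (Equiv.prodPUnit M.ι) (fun _ => 1)
/-- The braiding `e i ⊗ e k ↦ (-1)^{|e i| |e k|} e k ⊗ e i`. -/
def γm (M N : SfMod A) : Mat (tensor M N) (tensor N M) :=
  pm _ _ (Equiv.prodComm M.ι N.ι) (fun b => sgn (M.deg b.1 * N.deg b.2))

section nat
variable {M M' N N' P P' : SfMod A}

theorem αm_nat (p q r s s' : ℤ) (e : p + q = s) (e' : q + r = s') (f : Mat M M') (g : Mat N N') (k : Mat P P') :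
    αm M' N' P' * tmap s r (tmap p q f g) k = tmap p s' f (tmap q r g k) * αm M N P := by
  subst e e'
  ext ⟨j, l, u⟩ ⟨⟨i, t⟩, v⟩
  rw [αm, αm, pm_mul, mul_pm]
  change (1 : ℤ) • (sgn (r * (M.deg i + N.deg t) + (p + q + (M.deg i + N.deg t) -
    (M'.deg j + N'.deg l)) * P'.deg u) •
      ((sgn (q * M.deg i + (p + M.deg i - M'.deg j) * N'.deg l) • (f j i * g l t)) * k u v)) =
    (1 : ℤ) • (sgn ((q + r) * M.deg i + (p + M.deg i - M'.deg j) * (N'.deg l + P'.deg u)) •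
      (f j i * (sgn (r * N.deg t + (q + N.deg t - N'.deg l) * P'.deg u) • (g l t * k u v))))
  simp only [one_mul, smul_mul_assoc, mul_smul_comm, smul_smul, sgn_mul, mul_assoc]
  congr 1
  apply sgn_congr
  push_cast
  ring

theorem γm_nat (p q : ℤ) {f : Mat M M'} {g : Mat N N'} (hf : f ∈ homDeg M M' p)
    (hg : g ∈ homDeg N N' q) :
    γm M' N' * tmap p q f g = sgn (p * q) • (tmap q p g f * γm M N) := by
  ext ⟨l, j⟩ ⟨i, k⟩
  rw [Matrix.smul_apply, γm, γm, pm_mul, mul_pm]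
  change sgn (M'.deg j * N'.deg l) • (sgn (q * M.deg i + (p + M.deg i - M'.deg j) * N'.deg l) •
      (f j i * g l k)) = sgn (p * q) • (sgn (M.deg i * N.deg k) •
    (sgn (p * N.deg k + (q + N.deg k - N'.deg l) * M'.deg j) • (g l k * f j i)))
  rw [A.comm (hf j i) (hg l k)]
  simp only [smul_smul, sgn_mul]
  congr 1
  apply sgn_congr
  push_cast
  generalize (M.deg i : ZMod 2) = a1
  generalize (N'.deg l : ZMod 2) = a2
  generalize (M'.deg j : ZMod 2) = a3
  generalize (N.deg k : ZMod 2) = a6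
  generalize (p : ZMod 2) = a4
  generalize (q : ZMod 2) = a5
  revert a1 a2 a3 a4 a5 a6
  decide

theorem lm_nat (p : ℤ) (f : Mat M M') :
    lm M' * tmap 0 p (1 : Mat (I A) (I A)) f = f * lm M := by
  ext j ⟨⟨⟩, i⟩
  rw [lm, lm, pm_mul, mul_pm]
  change (1 : ℤ) • (sgn (p * 0 + (0 + 0 - 0) * M'.deg j) • ((1 : Mat (I A) (I A)) () () * f j i)) =
    (1 : ℤ) • f j i
  simp [sgn_zero]

theorem rm_nat (p : ℤ) (f : Mat M M') :
    rm M' * tmap p 0 f (1 : Mat (I A) (I A)) = f * rm M := by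
  ext j ⟨i, ⟨⟩⟩
  rw [rm, rm, pm_mul, mul_pm]
  change (1 : ℤ) • (sgn (0 * M.deg i + (p + M.deg i - M'.deg j) * 0) •
    (f j i * (1 : Mat (I A) (I A)) () ())) = (1 : ℤ) • f j i
  simp [sgn_zero]

end nat


section closed
variable {M N P : SfMod A}

theorem αm_D : (tensor M (tensor N P)).D * αm M N P = αm M N P * (tensor (tensor M N) P).D := by
  rw [tensor_D, tensor_D N P, tensor_D (tensor M N) P, tensor_D M N, ← tmap_one N P,
    ← tmap_one M N]
  simp only [map_add, LinearMap.add_apply, Matrix.add_mul, Matrix.mul_add,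
    αm_nat 1 0 0 1 0 rfl rfl, αm_nat 0 1 0 1 1 rfl rfl, αm_nat 0 0 1 0 1 rfl rfl]
  abel

theorem γm_D : (tensor N M).D * γm M N = γm M N * (tensor M N).D := by
  rw [tensor_D, tensor_D, Matrix.add_mul, Matrix.mul_add, γm_nat 1 0 M.D_mem' N.one_mem,
    γm_nat 0 1 M.one_mem N.D_mem']
  simp only [mul_zero, zero_mul, sgn_zero, one_smul]
  abel

theorem lm_D : M.D * lm M = lm M * (tensor (I A) M).D := by
  rw [tensor_D, Matrix.mul_add, lm_nat]
  simp

theorem rm_D : M.D * rm M = rm M * (tensor M (I A)).D := by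
  rw [tensor_D, Matrix.mul_add, rm_nat]
  simp

theorem inv_D {X : Mat M N} {Y : Mat N M} (h₁ : X * Y = 1) (h₂ : Y * X = 1)
    (h : N.D * X = X * M.D) : M.D * Y = Y * N.D := by
  have : Y * (N.D * X) * Y = Y * (X * M.D) * Y := by rw [h]
  rw [Matrix.mul_assoc, Matrix.mul_assoc N.D, h₁, Matrix.mul_one, ← Matrix.mul_assoc Y, h₂,
    Matrix.one_mul] at this
  exact this.symm

theorem pm_inv (σ : M.ι ≃ N.ι) : pm M N σ (fun _ => 1) * pm N M σ.symm (fun _ => 1) = 1 := by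
  rw [pm_pm]; simp [pm_one]

theorem pm_inv' (σ : M.ι ≃ N.ι) : pm N M σ.symm (fun _ => 1) * pm M N σ (fun _ => 1) = 1 := by
  rw [pm_pm]; simp [pm_one]

theorem γm_γm : γm N M * γm M N = 1 := by
  rw [γm, γm, pm_pm, ← pm_one]
  congr 1
  funext i
  change sgn (M.deg i.1 * N.deg i.2) * sgn (N.deg i.2 * M.deg i.1) = 1
  rw [mul_comm (N.deg i.2), sgn_sq]

/-- A closed permutation matrix. -/
def pmZ (σ : M.ι ≃ N.ι) (c : M.ι → ℤ) (h : ∀ i, N.deg (σ i) = M.deg i)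
    (h' : N.D * pm M N σ c = pm M N σ c * M.D) : Z0 M N :=
  ⟨pm M N σ c, pm_mem σ c h, pm_hd σ c h'⟩

end closed

def αZ (M N P : SfMod A) : Z0 (tensor (tensor M N) P) (tensor M (tensor N P)) :=
  pmZ (Equiv.prodAssoc M.ι N.ι P.ι) (fun _ => 1) (fun _ => (add_assoc _ _ _).symm) αm_D
def αZ' (M N P : SfMod A) : Z0 (tensor M (tensor N P)) (tensor (tensor M N) P) :=
  pmZ (Equiv.prodAssoc M.ι N.ι P.ι).symm (fun _ => 1) (fun _ => add_assoc _ _ _)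
    (inv_D (pm_inv _) (pm_inv' _) αm_D)
def lZ (M : SfMod A) : Z0 (tensor (I A) M) M :=
  pmZ (Equiv.punitProd M.ι) (fun _ => 1) (fun _ => (zero_add _).symm) lm_D
def lZ' (M : SfMod A) : Z0 M (tensor (I A) M) :=
  pmZ (Equiv.punitProd M.ι).symm (fun _ => 1) (fun _ => zero_add _)
    (inv_D (pm_inv _) (pm_inv' _) lm_D)
def rZ (M : SfMod A) : Z0 (tensor M (I A)) M :=
  pmZ (Equiv.prodPUnit M.ι) (fun _ => 1) (fun _ => (add_zero _).symm) rm_D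
def rZ' (M : SfMod A) : Z0 M (tensor M (I A)) :=
  pmZ (Equiv.prodPUnit M.ι).symm (fun _ => 1) (fun _ => add_zero _)
    (inv_D (pm_inv _) (pm_inv' _) rm_D)
def γZ (M N : SfMod A) : Z0 (tensor M N) (tensor N M) :=
  pmZ (Equiv.prodComm M.ι N.ι) (fun b => sgn (M.deg b.1 * N.deg b.2)) (fun _ => add_comm _ _) γm_D

theorem tmap_one_pm {M N P : SfMod A} (σ : N.ι ≃ P.ι) (c : N.ι → ℤ) :
    tmap 0 0 (1 : Mat M M) (pm N P σ c) =
      pm (tensor M N) (tensor M P) ((Equiv.refl M.ι).prodCongr σ) (fun b => c b.2) := by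
  ext ⟨j, l⟩ ⟨i, k⟩
  change sgn (0 * M.deg i + (0 + M.deg i - M.deg j) * P.deg l) •
    ((1 : Mat M M) j i * (if l = σ k then c k • (1 : A.carrier) else 0)) =
    if (j, l) = (i, σ k) then c k • (1 : A.carrier) else 0
  by_cases h1 : j = i
  · subst h1
    by_cases h2 : l = σ k <;> simp [h2, sgn_zero]
  · simp [h1]

theorem tmap_pm_one {M N P : SfMod A} (σ : N.ι ≃ P.ι) (c : N.ι → ℤ) (h : ∀ i, P.deg (σ i) = N.deg i) :
    tmap 0 0 (pm N P σ c) (1 : Mat M M) =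
      pm (tensor N M) (tensor P M) (σ.prodCongr (Equiv.refl M.ι)) (fun b => c b.1) := by
  ext ⟨l, j⟩ ⟨k, i⟩
  change sgn (0 * N.deg k + (0 + N.deg k - P.deg l) * M.deg j) •
    ((if l = σ k then c k • (1 : A.carrier) else 0) * (1 : Mat M M) j i) =
    if (l, j) = (σ k, i) then c k • (1 : A.carrier) else 0
  by_cases h1 : j = i
  · subst h1
    by_cases h2 : l = σ k <;> simp [h2, sgn_zero, h]
  · simp [h1]

theorem pm_congr {M N : SfMod A} {σ τ : M.ι ≃ N.ι} {c c' : M.ι → ℤ} (h : ∀ i, σ i = τ i)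
    (h' : ∀ i, c i = c' i) : pm M N σ c = pm M N τ c' := by
  rw [Equiv.ext h, funext h']

theorem pentagon_m (M N P Q : SfMod A) :
    tmap 0 0 (1 : Mat M M) (αm N P Q) *
      (αm M (tensor N P) Q * tmap 0 0 (αm M N P) (1 : Mat Q Q)) =
    αm M N (tensor P Q) * αm (tensor M N) P Q := by
  unfold αm
  rw [tmap_one_pm, tmap_pm_one _ _ fun _ => (add_assoc _ _ _).symm, pm_pm, pm_pm, pm_pm]
  exact pm_congr (fun _ => rfl) (fun _ => rfl)

theorem triangle_m (M N : SfMod A) :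
    tmap 0 0 (1 : Mat M M) (lm N) * αm M (I A) N = tmap 0 0 (rm M) (1 : Mat N N) := by
  unfold αm lm rm
  rw [tmap_one_pm, tmap_pm_one _ _ fun _ => (add_zero _).symm, pm_pm]
  exact pm_congr (fun _ => rfl) (fun _ => rfl)

theorem hexagon_m (M N P : SfMod A) :
    αm N P M * (γm M (tensor N P) * αm M N P) =
    tmap 0 0 (1 : Mat N N) (γm M P) * (αm N M P * tmap 0 0 (γm M N) (1 : Mat P P)) := by
  unfold αm γm
  rw [tmap_one_pm, tmap_pm_one _ _ fun _ => add_comm _ _, pm_pm, pm_pm, pm_pm, pm_pm]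
  refine pm_congr (fun _ => rfl) (fun b => ?_)
  change 1 * sgn (M.deg b.1.1 * (N.deg b.1.2 + P.deg b.2)) * 1 =
    sgn (M.deg b.1.1 * N.deg b.1.2) * 1 * sgn (M.deg b.1.1 * P.deg b.2)
  rw [mul_add, ← sgn_mul]
  ring

open CochainTwoCat in
/-- The symmetric monoidal structure `(⊗_A, A, γ)` on `Ho₂` of f.g. semi-free dg-modules; `γ` is the
Koszul braiding. -/
noncomputable def symMon (A : CDGA.{u, v} K) : SymMon K where
  cat := ho2 A
  tensor := (tensorBi A).toFun
  unit := I A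
  α := αZ
  αinv := αZ'
  lu := lZ
  luinv := lZ'
  ru := rZ
  ruinv := rZ'
  γ := γZ
  α_αinv _ _ _ := Subtype.ext (pm_inv _)
  αinv_α _ _ _ := Subtype.ext (pm_inv' _)
  lu_luinv _ := Subtype.ext (pm_inv _)
  luinv_lu _ := Subtype.ext (pm_inv' _)
  ru_ruinv _ := Subtype.ext (pm_inv _)
  ruinv_ru _ := Subtype.ext (pm_inv' _)
  γ_γ _ _ := Subtype.ext γm_γm
  α_nat f g k := Subtype.ext (αm_nat 0 0 0 0 0 rfl rfl f.1 g.1 k.1)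
  α_nat₁ φ g k := by
    induction φ using H1.ind with
    | h φ =>
    rw [BiFun.toFun_tL, BiFun.toFun_tL, BiFun.toFun_tL, BiFun.toFun_t₀]
    exact H1.mk_eq (αm_nat (-1) 0 0 (-1) 0 rfl rfl φ.1 g.1 k.1)
  α_nat₂ f φ k := by
    induction φ using H1.ind with
    | h φ =>
    rw [BiFun.toFun_tL, BiFun.toFun_tR, BiFun.toFun_tR, BiFun.toFun_tL]
    exact H1.mk_eq (αm_nat 0 (-1) 0 (-1) (-1) rfl rfl f.1 φ.1 k.1)
  α_nat₃ f g φ := by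
    induction φ using H1.ind with
    | h φ =>
    rw [BiFun.toFun_tR, BiFun.toFun_tR, BiFun.toFun_tR, BiFun.toFun_t₀]
    exact H1.mk_eq (αm_nat 0 0 (-1) 0 (-1) rfl rfl f.1 g.1 φ.1)
  lu_nat f := Subtype.ext (lm_nat 0 f.1)
  lu_nat₁ φ := by
    induction φ using H1.ind with
    | h φ =>
    rw [BiFun.toFun_tR]
    exact H1.mk_eq (lm_nat (-1) φ.1)
  ru_nat f := Subtype.ext (rm_nat 0 f.1)
  ru_nat₁ φ := by
    induction φ using H1.ind with
    | h φ =>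
    rw [BiFun.toFun_tL]
    exact H1.mk_eq (rm_nat (-1) φ.1)
  γ_nat f g := by
    refine Subtype.ext ((γm_nat 0 0 (z0_mem f) (z0_mem g)).trans ?_)
    rw [mul_zero, sgn_zero, one_smul]
    rfl
  γ_nat₁ φ g := by
    induction φ using H1.ind with
    | h φ =>
    rw [BiFun.toFun_tL, BiFun.toFun_tR]
    refine H1.mk_eq ((γm_nat (-1) 0 φ.2 (z0_mem g)).trans ?_)
    rw [mul_zero, sgn_zero, one_smul]
    rfl
  γ_nat₂ f φ := by
    induction φ using H1.ind with
    | h φ =>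
    rw [BiFun.toFun_tL, BiFun.toFun_tR]
    refine H1.mk_eq ((γm_nat 0 (-1) (z0_mem f) φ.2).trans ?_)
    rw [zero_mul, sgn_zero, one_smul]
    rfl
  pentagon M N P Q := Subtype.ext (pentagon_m M N P Q)
  triangle M N := Subtype.ext (triangle_m M N)
  hexagon M N P := Subtype.ext (hexagon_m M N P)

end SfMod

namespace CochainTwoCat
variable {R : Type u} [CommRing R]

/-- An infinitesimal 2-braiding: a pseudonatural endomorphism of `⊗ : C ⊠ C → C`. -/
abbrev InfBraiding (S : SymMon.{u, v, w} R) := PseudoNat S.tensor S.tensor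

namespace InfBraiding
variable {S : SymMon.{u, v, w} R} (t : InfBraiding S)

/-- The cochain component `t_{UV} : U ⊗ V ⟶ U ⊗ V`. -/
noncomputable def cochain (U V : S.cat.Obj) : S.cat.Hom₀ (S.tensor.tObj U V) (S.tensor.tObj U V) :=
  t.app (U, V)

/-- The homotopy component `t_{f ⊠ g}`. -/
noncomputable def homotopy {U U' V V' : S.cat.Obj} (f : S.cat.Hom₀ U U') (g : S.cat.Hom₀ V V') :
    S.cat.Hom₁ (S.tensor.tObj U V) (S.tensor.tObj U' V') :=
  t.hmt (U := (U, V)) (U' := (U', V')) (f ⊗ₜ[R] g)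

/-- `t` intertwines with `γ`: `γ_{UV} t_{UV} = t_{VU} γ_{UV}` and
`γ_{U'V'} t_{f ⊠ g} = t_{g ⊠ f} γ_{UV}`. -/
structure IsSymmetric : Prop where
  cochain_eq : ∀ U V,
    S.cat.comp (S.γ U V) (t.cochain U V) = S.cat.comp (t.cochain V U) (S.γ U V)
  homotopy_eq : ∀ {U U' V V'} (f : S.cat.Hom₀ U U') (g : S.cat.Hom₀ V V'),
    S.cat.lwh (S.γ U' V') (t.homotopy f g) = S.cat.rwh (S.γ U V) (t.homotopy g f)

/-- Total symmetry: `t` is symmetric and `t_{γ_{UV} ⊠ 1_W} = 0`. -/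
structure IsTotallySymmetric : Prop extends t.IsSymmetric where
  homotopy_γ : ∀ U V W, t.homotopy (S.γ U V) (S.cat.one W) = 0

/-- The Breen condition
`γ_{U(WV)} t_{1_U ⊠ γ_{VW}} + γ_{(VU)W} t_{γ_{UV} ⊠ 1_W} = 0`; the associators identify
the sources `(U ⊗ V) ⊗ W`, `U ⊗ (V ⊗ W)` and the targets `W ⊗ (V ⊗ U)`, `(W ⊗ V) ⊗ U`. -/
def IsBreen : Prop := ∀ U V W : S.cat.Obj,
  S.cat.rwh (S.α U V W)
      (S.cat.lwh (S.γ U (S.tensor.tObj W V)) (t.homotopy (S.cat.one U) (S.γ V W))) +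
    S.cat.lwh (S.αinv W V U)
      (S.cat.lwh (S.γ (S.tensor.tObj V U) W) (t.homotopy (S.γ U V) (S.cat.one W))) = 0

end InfBraiding
end CochainTwoCat

/-- An `n`-shifted Poisson structure on `A`.  A polyvector of weight `k`, i.e. an element of
`Sym^k_A (T_A[-n-1])`, is written as a graded symmetric `k`-fold multiderivation, where `a`
has the shifted degree `|a| - (n+1)`; so `π = ∑_{k ≥ 2} π^(k)` is the family `br k`, `k ≥ 2`, of
total degree `n+2`.  With `br 1 = d`, the field `mc` is the Maurer-Cartan equation
`d π + ½ [π, π] = 0` for the Schouten-Nijenhuis bracket. -/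
structure ShiftedPoisson {K : Type u} [Field K] (A : CDGA.{u, v} K) (n : ℤ) where
  br : ∀ k : ℕ, MultilinearMap K (fun _ : Fin k => A.carrier) A.carrier
  br_zero : br 0 = 0
  br_one : ∀ a, br 1 a = A.d (a 0)
  degree : ∀ {k : ℕ} {e : Fin k → ℤ} {a : Fin k → A.carrier}, (∀ i, a i ∈ A.gr (e i)) →
    br k a ∈ A.gr (∑ i, e i + (n + 2) - k * (n + 1))
  symm : ∀ {k : ℕ} {e : Fin k → ℤ} {a : Fin k → A.carrier}, (∀ i, a i ∈ A.gr (e i)) →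
    ∀ s : Equiv.Perm (Fin k), br k a =
      sgn (∑ i, ∑ j, if i < j ∧ s j < s i then (e (s i) - (n + 1)) * (e (s j) - (n + 1)) else 0) •
        br k (a ∘ s)
  derivation : ∀ {k : ℕ} {e : Fin k → ℤ} {a : Fin k → A.carrier}, (∀ i, a i ∈ A.gr (e i)) →
    ∀ {m : ℤ} {b : A.carrier}, b ∈ A.gr m → ∀ c : A.carrier,
      br (k + 1) (Fin.snoc (α := fun _ => A.carrier) a (b * c)) =
        br (k + 1) (Fin.snoc (α := fun _ => A.carrier) a b) * c +
          sgn ((1 + ∑ i, (e i - (n + 1))) * m) •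
            (b * br (k + 1) (Fin.snoc (α := fun _ => A.carrier) a c))
  mc : ∀ {k : ℕ} {e : Fin k → ℤ} {a : Fin k → A.carrier}, (∀ i, a i ∈ A.gr (e i)) →
    ∑ s : Finset (Fin k),
      sgn (∑ i, ∑ j, if i < j ∧ i ∉ s ∧ j ∈ s then (e i - (n + 1)) * (e j - (n + 1)) else 0) •
        br (sᶜ.card + 1) (Fin.cons (α := fun _ => A.carrier)
          (br s.card fun i => a (s.orderEmbOfFin rfl i)) fun i => a (sᶜ.orderEmbOfFin rfl i)) = 0

namespace ShiftedPoisson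
variable {K : Type u} [Field K] {A : CDGA.{u, v} K}

/-- `⟨π^(2), da ⊗ db⟩`, the weight two term as a biderivation. -/
def pair {n : ℤ} (π : ShiftedPoisson A n) (a b : A.carrier) : A.carrier := π.br 2 ![a, b]

open SfMod in
/-- For homogeneous maps `P : M → M'`, `Q : N → N'` of degrees `p`, `q`, let
`∇P : M → Ω_A[1] ⊗ M'` be the `A`-linear map of degree `p - 1` obtained by applying the de Rham
differential to the matrix entries in the chosen bases.  This is the matrix of
`(⟨π^(2), ·⟩ ⊗ 1) (1 ⊗ γ ⊗ 1) (∇P ⊗ ∇Q) : M ⊗ N → M' ⊗ N'`. -/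
def contract (π : ShiftedPoisson A 2) {M M' N N' : SfMod A} (p q : ℤ)
    (P : Mat M M') (Q : Mat N N') : Mat (tensor M N) (tensor M' N') :=
  Matrix.of fun a b =>
    sgn (M'.deg a.1 + (q - 1) * M.deg b.1 + (p + M.deg b.1 - M'.deg a.1) * N'.deg a.2) •
      π.pair (P a.1 b.1) (Q a.2 b.2)

open SfMod in
/-- The matrix of the homotopy
`t_{f ⊠ g} = ⟨π^(2), ·⟩ ((ξ_f ⊗ (1 ⊗ g) ξ_N) + (ξ_{M'} f ⊗ ξ_g))`, where `ξ_M = ∇ D_M` is the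
Atiyah class of `M` and `ξ_f = -∇ f` its homotopy component. -/
def homotopyMat (π : ShiftedPoisson A 2) {M M' N N' : SfMod A} (f : Mat M M') (g : Mat N N') :
    Mat (tensor M N) (tensor M' N') :=
  -(tmap 0 0 (1 : Mat M' M') g * π.contract (N := N) (N' := N) 0 1 f N.D) -
    π.contract (M := M') (M' := M') 1 0 M'.D g * tmap 0 0 f (1 : Mat N N)

/-- `t` is the infinitesimal 2-braiding induced by the 2-shifted Poisson structure `π`:
`t_{MN} = (⟨π^(2), ·⟩ ⊗ 1) (1 ⊗ γ ⊗ 1) (ξ_M ⊗ ξ_N)`, and `t_{f ⊠ g}` is the class of the homotopy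
built from `π^(2)`, `ξ` and its homotopy components. -/
structure Induces (π : ShiftedPoisson A 2)
    (t : CochainTwoCat.InfBraiding (SfMod.symMon A)) : Prop where
  cochain_eq : ∀ M N : SfMod A,
    (t.cochain M N : SfMod.Z0 (SfMod.tensor M N) (SfMod.tensor M N)).1 =
      π.contract (M := M) (M' := M) (N := N) (N' := N) 1 1 M.D N.D
  homotopy_eq : ∀ {M M' N N' : SfMod A} (f : SfMod.Z0 M M') (g : SfMod.Z0 N N'),
    ∃ φ : SfMod.homDeg (SfMod.tensor M N) (SfMod.tensor M' N') (-1),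
      φ.1 = π.homotopyMat f.1 g.1 ∧ t.homotopy f g = SfMod.H1.mk φ

end ShiftedPoisson

/-! Read `π^(2)` as a bracket `{a, b}` on `A`: a biderivation of degree `-2`, graded symmetric for
shifted degrees. The arity-two component of the Maurer–Cartan equation says that this bracket is
compatible with `d` (`d_pair`); this is the input from `π` on which closedness rests.

Entrywise differentiation `∇` lowers degree by one and obeys a Leibniz rule for matrix products, so
`contract p q P Q`, the matrix of `ι_π(∇P ⊗ ∇Q)`, satisfies a Leibniz rule in each slot
(`contract_mul_left`, `contract_mul_right`), and the entrywise differential passes into it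
(`dm_contract`). Together with flatness of `D_N` this gives the key identity `hd_contract_D_right`:
up to the term with `∇(hd P)`, the coboundary of `ι_π(∇P ⊗ ∇D_N)` is the commutator of `t` with `P ⊗
1`. There is a mirror identity `hd_contract_D_left`. Taking `P = D_M` shows that `t_{MN}` is closed;
taking `P` closed of degree `0` gives homotopies for naturality in each variable; taking `P` of
degree `-1` gives compatibility with 2-cells.

The homotopy `t_{f ⊠ g}` moves `f` first and `g` second. The other order gives a homotopy that
differs from it by the coboundary of `ι_π(∇f ⊗ ∇g)` (`hd_contract_closed`). This single degree `-2`
correction accounts both for composition (`homotopyMat_comp`) and for symmetry under `γ`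
(`homotopyMat_symm`).

Finally, the matrices of `γ` and of identities have entries in the integers, and `∇` kills these. So
`t_{γ ⊠ 1}` and `t_{1 ⊠ γ}` vanish already as matrices (`homotopyMat_pm`), which gives both total
symmetry and the Breen condition. As the formula prescribes all components, the argument applies to
every `t` induced by `π`. -/

namespace ShiftedPoisson
variable {K : Type u} [Field K] {A : CDGA.{u, v} K}

/-! ### The weight-two bracket as a biderivation; the Maurer–Cartan equation in arity two. -/

section Pair
variable {n : ℤ} (π : ShiftedPoisson A n)

/-- `pair` as a bilinear map. -/
def pairₗ : A.carrier →ₗ[K] A.carrier →ₗ[K] A.carrier :=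
  LinearMap.mk₂ K π.pair
    (fun a a' b => (π.br 2).cons_add ![b] a a')
    (fun c a b => (π.br 2).cons_smul ![b] c a)
    (fun a b b' => by
      have h : ∀ x : A.carrier, ![a, x] = Fin.snoc (α := fun _ => A.carrier) ![a] x := by
        intro x; ext i; fin_cases i <;> rfl
      simp only [pair, h]
      exact (π.br 2).snoc_add ![a] b b')
    (fun c a b => by
      have h : ∀ x : A.carrier, ![a, x] = Fin.snoc (α := fun _ => A.carrier) ![a] x := by
        intro x; ext i; fin_cases i <;> rfl
      simp only [pair, h]
      exact (π.br 2).snoc_smul ![a] c b)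

theorem pairₗ_apply (a b : A.carrier) : π.pairₗ a b = π.pair a b := rfl

theorem homogeneous_vec {i j : ℤ} {a b : A.carrier} (ha : a ∈ A.gr i) (hb : b ∈ A.gr j) :
    ∀ k : Fin 2, ![a, b] k ∈ A.gr (![i, j] k) := by
  intro k; fin_cases k <;> assumption

theorem pair_comm {i j : ℤ} {a b : A.carrier} (ha : a ∈ A.gr i) (hb : b ∈ A.gr j) :
    π.pair a b = sgn ((i - (n + 1)) * (j - (n + 1))) • π.pair b a := by
  have h := π.symm (homogeneous_vec ha hb) (Equiv.swap 0 1)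
  have h' : ![a, b] ∘ Equiv.swap (0 : Fin 2) 1 = ![b, a] := by
    ext k; fin_cases k <;> rfl
  rw [h'] at h
  refine h.trans ?_
  simp [Fin.sum_univ_two, mul_comm, pair]

theorem pair_mul_right {i j : ℤ} {a b : A.carrier} (ha : a ∈ A.gr i) (hb : b ∈ A.gr j)
    (c : A.carrier) :
    π.pair a (b * c) = π.pair a b * c + sgn ((1 + (i - (n + 1))) * j) • (b * π.pair a c) := by
  have h := π.derivation (k := 1) (e := ![i]) (a := ![a])
    (fun k => by fin_cases k; exact ha) hb c
  have h' : ∀ x : A.carrier, Fin.snoc (α := fun _ => A.carrier) ![a] x = ![a, x] := by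
    intro x; ext i; fin_cases i <;> rfl
  simpa [h', pair] using h

theorem pair_one_right (a : A.carrier) : π.pair a 1 = 0 := by
  classical
  change π.pairₗ a 1 = 0
  induction a using DirectSum.Decomposition.inductionOn A.gr with
  | zero => simp
  | @homogeneous i m =>
    -- The Leibniz rule on `1 * 1` reads `x = x + x`, the sign being trivial since `1` has degree
    -- `0`.
    have h := π.pair_mul_right m.2 (SetLike.GradedOne.one_mem (A := A.gr)) 1
    rw [pairₗ_apply]
    simpa [sgn_zero] using h
  | add m m' h h' => rw [map_add, LinearMap.add_apply, h, h', add_zero]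

theorem pair_one_left (a : A.carrier) : π.pair 1 a = 0 := by
  classical
  change π.pairₗ 1 a = 0
  induction a using DirectSum.Decomposition.inductionOn A.gr with
  | zero => simp
  | @homogeneous i m =>
    rw [pairₗ_apply, π.pair_comm (SetLike.GradedOne.one_mem (A := A.gr)) m.2, pair_one_right,
      smul_zero]
  | add m m' h h' => rw [map_add, h, h', add_zero]

/-- The arities in the Maurer–Cartan sum are cardinalities of subsets rather than numerals, so
brackets must be transported along equalities of arities. -/
theorem br_congr {k l : ℕ} (h : k = l) (a : Fin k → A.carrier) (b : Fin l → A.carrier)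
    (hab : ∀ i, a i = b (Fin.cast h i)) : π.br k a = π.br l b := by
  subst h; exact congrArg _ (funext hab)

/-- In arity two the Maurer–Cartan sum has four terms. The empty subset contributes `br 0 = 0`, each
singleton puts `br 1 = d` inside `br 2`, and the full subset puts `br 2` inside `br 1 = d`. -/
theorem d_pair_aux {i j : ℤ} {a b : A.carrier} (ha : a ∈ A.gr i) (hb : b ∈ A.gr j) :
    A.d (π.pair a b) + π.pair (A.d a) b +
      sgn ((i - (n + 1)) * (j - (n + 1))) • π.pair (A.d b) a = 0 := by
  have h := π.mc (homogeneous_vec ha hb)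
  have e : (Finset.univ : Finset (Finset (Fin 2))) = {∅, {0}, {1}, {0, 1}} := by decide
  -- Both singleton terms at once: `s` holds the argument that is differentiated, `t` is its
  -- complement.
  have hs : ∀ (s t : Finset (Fin 2)) (x y : A.carrier) (hsc : s.card = 1) (htc : t.card = 1)
      (hx : ∀ k ∈ s, ![a, b] k = x) (hy : ∀ k ∈ t, ![a, b] k = y),
      π.br (t.card + 1) (Fin.cons (α := fun _ => A.carrier)
          (π.br s.card fun i => ![a, b] (s.orderEmbOfFin rfl i))
            fun i => ![a, b] (t.orderEmbOfFin rfl i)) = π.pair (A.d x) y := by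
    intro s t x y hsc htc hx hy
    refine π.br_congr (by rw [htc]) _ ![A.d x, y] fun k => ?_
    induction k using Fin.cases with
    | zero =>
      change π.br s.card _ = A.d x
      refine (π.br_congr hsc _ ![x] fun k => ?_).trans (π.br_one ![x])
      exact (hx _ (Finset.orderEmbOfFin_mem s rfl k)).trans (by simp)
    | succ k =>
      refine (hy _ (Finset.orderEmbOfFin_mem t rfl k)).trans ?_
      have : Fin.cast (by rw [htc]) k.succ = (1 : Fin 2) := by ext; simp
      rw [this]; rfl
  have h0 : ∀ v : Fin (Finset.card (∅ : Finset (Fin 2))) → A.carrier,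
      π.br (Finset.card (∅ : Finset (Fin 2))) v = 0 := by
    intro v; change π.br 0 v = 0; rw [π.br_zero]; rfl
  -- The full subset: its complement is empty, so the outer bracket is `br 1 = d`.
  have h2 : π.br (Finset.card ({0, 1}ᶜ : Finset (Fin 2)) + 1) (Fin.cons (α := fun _ => A.carrier)
      (π.br (Finset.card {0, 1}) fun i => ![a, b] (({0, 1} : Finset (Fin 2)).orderEmbOfFin rfl i))
      fun i => ![a, b] (({0, 1}ᶜ : Finset (Fin 2)).orderEmbOfFin rfl i)) = A.d (π.pair a b) := by
    refine (π.br_congr (by decide) _ ![π.pair a b] fun k => ?_).trans (π.br_one _)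
    induction k using Fin.cases with
    | zero =>
      refine π.br_congr (by decide) _ ![a, b] fun k => ?_
      congr 1
      -- The increasing enumeration of `{0, 1}` is the identity, because a strictly monotone
      -- enumeration is unique.
      exact (congrFun (Finset.orderEmbOfFin_unique (s := {0, 1}) (k := 2) rfl (f := id)
        (by decide) strictMono_id) k).symm
    | succ k =>
      exact absurd (k.2.trans_eq (show _ = 0 by decide)) (Nat.not_lt_zero _)
  have c0 : ∀ k : Fin 2, k ∈ ({0} : Finset (Fin 2)) ∨ k ∈ ({1}ᶜ : Finset (Fin 2)) → k = 0 := by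
    decide
  have c1 : ∀ k : Fin 2, k ∈ ({1} : Finset (Fin 2)) ∨ k ∈ ({0}ᶜ : Finset (Fin 2)) → k = 1 := by
    decide
  rw [e, Finset.sum_insert (by decide), Finset.sum_insert (by decide),
    Finset.sum_insert (by decide), Finset.sum_singleton, h2, h0,
    hs {0} _ a b (by decide) (by decide) (fun k hk => by rw [c0 k (.inl hk)]; rfl)
      (fun k hk => by rw [c1 k (.inr hk)]; rfl),
    hs {1} _ b a (by decide) (by decide) (fun k hk => by rw [c1 k (.inl hk)]; rfl)
      (fun k hk => by rw [c0 k (.inr hk)]; rfl),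
    -- The term of the empty subset has a zero in its first slot, so multilinearity removes it.
    show ∀ (k : ℕ) (v : Fin k → A.carrier),
      π.br (k + 1) (Fin.cons (α := fun _ => A.carrier) 0 v) = 0 from
        fun k v => (π.br (k + 1)).map_coord_zero 0 rfl] at h
  rw [← h]
  simp [Fin.sum_univ_two, sgn_zero]
  abel

end Pair
end ShiftedPoisson

/-- Koszul signs are compared as polynomial identities in the degrees modulo 2; squares of degrees
are reduced by this idempotence. -/
theorem zmod_two_mul_self : ∀ a : ZMod 2, a * a = a := by decide

namespace ShiftedPoisson
variable {K : Type u} [Field K] {A : CDGA.{u, v} K}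

/-! ### Sign rules of the bracket for shift two. -/

section TwoShifted
variable (π : ShiftedPoisson A 2)

theorem pair_mem {i j k : ℤ} {a b : A.carrier} (ha : a ∈ A.gr i) (hb : b ∈ A.gr j)
    (h : i + j - 2 = k) : π.pair a b ∈ A.gr k := by
  refine A.gr_cast (π.degree (homogeneous_vec ha hb)) ?_
  simp [Fin.sum_univ_two]
  lia

/-- The shift by `n + 1 = 3` is odd, so only `i + 1` and `j + 1` matter modulo 2. -/
theorem pair_swap {i j : ℤ} {a b : A.carrier} (ha : a ∈ A.gr i) (hb : b ∈ A.gr j) :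
    π.pair a b = sgn ((i + 1) * (j + 1)) • π.pair b a := by
  rw [π.pair_comm ha hb]
  congr 1
  apply sgn_congr
  push_cast
  grind

theorem pair_mul {i j : ℤ} {a b : A.carrier} (ha : a ∈ A.gr i) (hb : b ∈ A.gr j)
    (c : A.carrier) :
    π.pair a (b * c) = π.pair a b * c + sgn (i * j) • (b * π.pair a c) := by
  rw [π.pair_mul_right ha hb]
  congr 2
  apply sgn_congr
  push_cast
  grind

/-- The Leibniz rule in the first slot follows from the one in the second by symmetry, swapping
before and after. -/
theorem mul_pair {i j k : ℤ} {a b c : A.carrier} (ha : a ∈ A.gr i) (hb : b ∈ A.gr j)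
    (hc : c ∈ A.gr k) :
    π.pair (a * b) c = sgn (j * (k + 1)) • (π.pair a c * b) + sgn i • (a * π.pair b c) := by
  rw [π.pair_swap (A.gr_mul ha hb rfl) hc, π.pair_mul hc ha, π.pair_swap hc ha,
    π.pair_swap hc hb]
  simp only [smul_add, smul_smul, smul_mul_assoc, mul_smul_comm, sgn_mul]
  congr 2 <;>
  · apply sgn_congr
    push_cast
    grind [zmod_two_mul_self]

theorem d_pair {i j : ℤ} {a b : A.carrier} (ha : a ∈ A.gr i) (hb : b ∈ A.gr j) :
    A.d (π.pair a b) = -π.pair (A.d a) b + sgn i • π.pair a (A.d b) := by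
  have h := π.d_pair_aux ha hb
  -- The Maurer–Cartan term carries `d b` in its first slot; the swap moves it to the second, and
  -- the two signs combine to `-(-1)^i`.
  rw [π.pair_swap (A.d_mem hb) ha, smul_smul, sgn_mul,
    show sgn ((i - (2 + 1)) * (j - (2 + 1)) + (j + 1 + 1) * (i + 1)) = -sgn i by
      rw [← neg_one_mul, ← sgn_one, sgn_mul]
      apply sgn_congr
      push_cast
      grind [zmod_two_mul_self]] at h
  rw [← sub_eq_zero, ← h, neg_smul]
  abel

end TwoShifted
end ShiftedPoisson

/-! ### Matrix entries of composites with `f ⊗ 1` and `1 ⊗ g`. -/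

namespace SfMod
variable {K : Type u} [Field K] {A : CDGA.{u, v} K} {M M' N N' P : SfMod A}

theorem tmap_apply (p q : ℤ) (f : Mat M M') (g : Mat N N') (j l i k) :
    tmap p q f g (j, l) (i, k) =
      sgn (q * M.deg i + (p + M.deg i - M'.deg j) * N'.deg l) • (f j i * g l k) := rfl

theorem mul_tmap_one_right (p : ℤ) (X : Mat (tensor M' N) P) (f : Mat M M') (a : P.ι)
    (i : M.ι) (k : N.ι) : (X * tmap p 0 f (1 : Mat N N)) a (i, k) =
      ∑ j, sgn ((p + M.deg i - M'.deg j) * N.deg k) • (X a (j, k) * f j i) := by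
  simp only [Matrix.mul_apply, Fintype.sum_prod_type, tmap_apply, Matrix.one_apply]
  simp [-zsmul_eq_mul]

theorem mul_tmap_one_left (q : ℤ) (X : Mat (tensor M N') P) (g : Mat N N') (a : P.ι)
    (i : M.ι) (k : N.ι) : (X * tmap 0 q (1 : Mat M M) g) a (i, k) =
      ∑ l, sgn (q * M.deg i) • (X a (i, l) * g l k) := by
  simp only [Matrix.mul_apply, Fintype.sum_prod_type, tmap_apply, Matrix.one_apply]
  rw [Finset.sum_comm]
  simp [-zsmul_eq_mul]

theorem tmap_one_right_mul (p : ℤ) (X : Mat P (tensor M N)) (f : Mat M M') (b : P.ι)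
    (j : M'.ι) (l : N.ι) : (tmap p 0 f (1 : Mat N N) * X) (j, l) b =
      ∑ i, sgn ((p + M.deg i - M'.deg j) * N.deg l) • (f j i * X (i, l) b) := by
  simp only [Matrix.mul_apply, Fintype.sum_prod_type, tmap_apply, Matrix.one_apply]
  simp [-zsmul_eq_mul]

theorem tmap_one_left_mul (q : ℤ) (X : Mat P (tensor M N)) (g : Mat N N') (b : P.ι)
    (j : M.ι) (l : N'.ι) : (tmap 0 q (1 : Mat M M) g * X) (j, l) b =
      ∑ k, sgn (q * M.deg j) • (g l k * X (j, k) b) := by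
  simp only [Matrix.mul_apply, Fintype.sum_prod_type, tmap_apply, Matrix.one_apply]
  rw [Finset.sum_comm]
  simp [-zsmul_eq_mul]

end SfMod

namespace ShiftedPoisson
variable {K : Type u} [Field K] {A : CDGA.{u, v} K}

open SfMod

/-! ### Leibniz calculus for `ι_π(∇P ⊗ ∇Q)`. -/

section Contract
variable (π : ShiftedPoisson A 2) {M M' M'' N N' N'' : SfMod A}

/-- `contract` as a bilinear map. -/
def contractₗ (M M' N N' : SfMod A) (p q : ℤ) :
    Mat M M' →ₗ[K] Mat N N' →ₗ[K] Mat (tensor M N) (tensor M' N') :=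
  LinearMap.mk₂ K (π.contract p q)
    (fun f f' g => by ext; simp [contract, ← pairₗ_apply])
    (fun c f g => by ext; simp [contract, ← pairₗ_apply, smul_comm])
    (fun f g g' => by ext; simp [contract, ← pairₗ_apply])
    (fun c f g => by ext; simp [contract, ← pairₗ_apply, smul_comm])

theorem contractₗ_apply (p q : ℤ) (f : Mat M M') (g : Mat N N') :
    π.contractₗ M M' N N' p q f g = π.contract p q f g := rfl

theorem contract_apply (p q : ℤ) (f : Mat M M') (g : Mat N N') (j l i k) :
    π.contract p q f g (j, l) (i, k) =
      sgn (M'.deg j + (q - 1) * M.deg i + (p + M.deg i - M'.deg j) * N'.deg l) •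
        π.pair (f j i) (g l k) := rfl

theorem contract_mem {p q r : ℤ} {f : Mat M M'} {g : Mat N N'} (hf : f ∈ homDeg M M' p)
    (hg : g ∈ homDeg N N' q) (e : p + q - 2 = r) :
    π.contract p q f g ∈ homDeg (tensor M N) (tensor M' N') r := by
  rintro ⟨j, l⟩ ⟨i, k⟩
  exact A.gr_sgn _ (π.pair_mem (hf j i) (hg l k) (by
    change _ = M.deg i + N.deg k + r - (M'.deg j + N'.deg l); lia))

/-- `∇` is odd, so `∇(f' f) = (∇f') f + (-1)^{p'} f' ∇f`. In the first summand `f` must also pass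
`∇g`, of degree `q - 1`, which produces the sign `(-1)^{p (q + 1)}`. -/
theorem contract_mul_left {p p' q r : ℤ} {f' : Mat M' M''} {f : Mat M M'} {g : Mat N N'}
    (hf' : f' ∈ homDeg M' M'' p') (hf : f ∈ homDeg M M' p) (hg : g ∈ homDeg N N' q)
    (e : p' + p = r) :
    π.contract r q (f' * f) g =
      sgn (p * (q + 1)) • (π.contract p' q f' g * tmap p 0 f (1 : Mat N N)) +
        sgn p' • (tmap p' 0 f' (1 : Mat N' N') * π.contract p q f g) := by
  subst e
  ext ⟨j, l⟩ ⟨i, k⟩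
  rw [Matrix.add_apply, Matrix.smul_apply, Matrix.smul_apply, mul_tmap_one_right,
    tmap_one_right_mul, contract_apply, Matrix.mul_apply, ← pairₗ_apply, map_sum,
    LinearMap.sum_apply]
  simp only [Finset.smul_sum, ← Finset.sum_add_distrib, contract_apply, pairₗ_apply]
  refine Finset.sum_congr rfl fun m _ => ?_
  rw [π.mul_pair (hf' j m) (hf m i) (hg l k)]
  simp only [smul_add, smul_smul, smul_mul_assoc, mul_smul_comm, sgn_mul]
  congr 2 <;>
  · apply sgn_congr
    push_cast
    grind [zmod_two_mul_self]

/-- Here `g'` passes both `∇` and `∇f`, of degree `p - 1`; the signs `(-1)^{q'}` and `(-1)^{q' (p -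
1)}` multiply to `(-1)^{q' p}`. -/
theorem contract_mul_right {p q q' r : ℤ} {f : Mat M M'} {g' : Mat N' N''} {g : Mat N N'}
    (hf : f ∈ homDeg M M' p) (hg' : g' ∈ homDeg N' N'' q') (e : q' + q = r) :
    π.contract p r f (g' * g) =
      π.contract p q' f g' * tmap 0 q (1 : Mat M M) g +
        sgn (q' * p) • (tmap 0 q' (1 : Mat M' M') g' * π.contract p q f g) := by
  subst e
  ext ⟨j, l⟩ ⟨i, k⟩
  rw [Matrix.add_apply, Matrix.smul_apply, mul_tmap_one_left,
    tmap_one_left_mul, contract_apply, Matrix.mul_apply, ← pairₗ_apply, map_sum]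
  simp only [Finset.smul_sum, ← Finset.sum_add_distrib, contract_apply, pairₗ_apply]
  refine Finset.sum_congr rfl fun m _ => ?_
  rw [π.pair_mul (hf j i) (hg' l m)]
  simp only [smul_add, smul_smul, smul_mul_assoc, mul_smul_comm, sgn_mul]
  congr 2 <;>
  · apply sgn_congr
    push_cast
    grind [zmod_two_mul_self]

/-- The differential anticommutes with the odd operator `∇`, whence the first minus sign. In the
second term it also passes `∇f` of degree `p - 1`, and the signs combine to `(-1)^p`. -/
theorem dm_contract {p q p' q' : ℤ} {f : Mat M M'} {g : Mat N N'} (hf : f ∈ homDeg M M' p)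
    (hg : g ∈ homDeg N N' q) (hp : p + 1 = p') (hq : q + 1 = q') :
    dm (tensor M N) (tensor M' N') (π.contract p q f g) =
      -π.contract p' q (dm M M' f) g + sgn p • π.contract p q' f (dm N N' g) := by
  subst hp hq
  ext ⟨j, l⟩ ⟨i, k⟩
  rw [Matrix.add_apply, Matrix.smul_apply, Matrix.neg_apply, dm_apply]
  simp only [contract_apply, dm_apply, map_zsmul, π.d_pair (hf j i) (hg l k)]
  simp only [← pairₗ_apply, map_zsmul, LinearMap.smul_apply]
  simp only [smul_add, smul_smul, smul_neg, sgn_mul]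
  congr 2
  · congr 1
    apply sgn_congr
    push_cast
    grind [zmod_two_mul_self]
  · apply sgn_congr
    push_cast
    grind [zmod_two_mul_self]

/-- The pairing is graded symmetric of degree zero on `Ω_A[1]`, so only the Koszul sign of
exchanging `∇f` and `∇g` remains. -/
theorem γm_contract {p q : ℤ} {f : Mat M M'} {g : Mat N N'} (hf : f ∈ homDeg M M' p)
    (hg : g ∈ homDeg N N' q) :
    γm M' N' * π.contract p q f g =
      sgn ((p + 1) * (q + 1)) • (π.contract q p g f * γm M N) := by
  ext ⟨l, j⟩ ⟨i, k⟩
  rw [Matrix.smul_apply, γm, γm, pm_mul, mul_pm]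
  change sgn (M'.deg j * N'.deg l) • π.contract p q f g (j, l) (i, k) =
    sgn ((p + 1) * (q + 1)) • (sgn (M.deg i * N.deg k) • π.contract q p g f (l, j) (k, i))
  rw [contract_apply, contract_apply, π.pair_swap (hf j i) (hg l k)]
  simp only [smul_smul, sgn_mul]
  congr 1
  apply sgn_congr
  push_cast
  grind [zmod_two_mul_self]

/-- The entries are integer multiples of `1`, on which a derivation vanishes. -/
theorem contract_pm_left (p q : ℤ) (σ : M.ι ≃ M'.ι) (c : M.ι → ℤ) (g : Mat N N') :
    π.contract p q (pm M M' σ c) g = 0 := by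
  ext ⟨j, l⟩ ⟨i, k⟩
  rw [contract_apply, pm, Matrix.of_apply, ← pairₗ_apply]
  split_ifs <;> simp only [map_zsmul, LinearMap.smul_apply, map_zero, LinearMap.zero_apply,
    pairₗ_apply, pair_one_left, smul_zero, Matrix.zero_apply]

theorem contract_pm_right (p q : ℤ) (σ : N.ι ≃ N'.ι) (c : N.ι → ℤ) (f : Mat M M') :
    π.contract p q f (pm N N' σ c) = 0 := by
  ext ⟨j, l⟩ ⟨i, k⟩
  rw [contract_apply, pm, Matrix.of_apply, ← pairₗ_apply]
  split_ifs <;> simp only [map_zsmul, map_zero, pairₗ_apply, pair_one_right, smul_zero,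
    Matrix.zero_apply]

end Contract
end ShiftedPoisson

/-- Splitting on the value of a symbolic sign leaves identities with coefficients `1` and `-1`,
which are then purely additive. -/
theorem sgn_eq_one_or (n : ℤ) : sgn n = 1 ∨ sgn n = -1 := by
  rcases Int.even_or_odd n with h | h
  · left; simp [sgn, Int.negOnePow_even n h]
  · right; simp [sgn, Int.negOnePow_odd n h]

namespace ShiftedPoisson
variable {K : Type u} [Field K] {A : CDGA.{u, v} K}

open SfMod

/-! ### Coboundaries of contractions: closedness and naturality homotopies. -/

section HomDifferential
variable (π : ShiftedPoisson A 2) {M M' M'' N N' N'' : SfMod A}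

theorem contract_hd_left (p q r : ℤ) (f : Mat M M') (g : Mat N N') :
    π.contract r q (hd M M' p f) g = π.contract r q (M'.D * f) g + π.contract r q (dm M M' f) g -
      sgn p • π.contract r q (f * M.D) g := by
  simp only [← contractₗ_apply, hd_apply, map_add, map_sub, map_zsmul, LinearMap.add_apply,
    LinearMap.sub_apply, LinearMap.smul_apply]

theorem contract_hd_right (p q r : ℤ) (f : Mat M M') (g : Mat N N') :
    π.contract p r f (hd N N' q g) = π.contract p r f (N'.D * g) + π.contract p r f (dm N N' g) -
      sgn q • π.contract p r f (g * N.D) := by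
  simp only [← contractₗ_apply, hd_apply, map_add, map_sub, map_zsmul]

theorem contract_neg_left (p q : ℤ) (f : Mat M M') (g : Mat N N') :
    π.contract p q (-f) g = -π.contract p q f g := by
  simp only [← contractₗ_apply, map_neg, LinearMap.neg_apply]

theorem contract_neg_right (p q : ℤ) (f : Mat M M') (g : Mat N N') :
    π.contract p q f (-g) = -π.contract p q f g := by
  simp only [← contractₗ_apply, map_neg]

theorem contract_zero_left (p q : ℤ) (g : Mat N N') :
    π.contract p q (0 : Mat M M') g = 0 := by
  simp only [← contractₗ_apply, map_zero, LinearMap.zero_apply]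

theorem contract_zero_right (p q : ℤ) (f : Mat M M') :
    π.contract p q f (0 : Mat N N') = 0 := by
  simp only [← contractₗ_apply, map_zero]

/-- Applying `∇` to `hd f` gives, besides `f` differentiated, the terms in which `D_{M'}` or `D_M`
is differentiated; paired with `∇D_N` these are the two terms of the commutator of `t` with `f ⊗ 1`.
-/
theorem hd_contract_D_right {p p' r : ℤ} {f : Mat M M'} (N : SfMod A) (hf : f ∈ homDeg M M' p)
    (hp : p + 1 = p') (hr : p - 1 = r) :
    hd (tensor M N) (tensor M' N) r (π.contract p 1 f N.D) =
      -π.contract p' 1 (hd M M' p f) N.D +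
        (π.contract 1 1 M'.D N.D * tmap p 0 f (1 : Mat N N) -
          tmap p 0 f (1 : Mat N N) * π.contract 1 1 M.D N.D) := by
  subst hp hr
  rw [hd_apply, tensor_D, tensor_D, Matrix.add_mul, Matrix.mul_add,
    -- Flatness replaces the entrywise differential of `D_N` by `-D_N D_N`; the Leibniz expansion of
    -- that product cancels the contribution of `1 ⊗ D_N` to the hom differential.
    π.dm_contract hf N.D_mem' rfl rfl, dm_D, contract_neg_right, contract_hd_left,
    π.contract_mul_left M'.D_mem' hf N.D_mem' (add_comm 1 p),
    π.contract_mul_left hf M.D_mem' N.D_mem' rfl,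
    π.contract_mul_right (q := 1) hf N.D_mem' rfl,
    show sgn (p - 1) = -sgn p by rw [sub_eq_add_neg, ← sgn_mul, sgn_neg_one]; ring,
    show sgn (p * (1 + 1)) = 1 by rw [← sgn_zero]; apply sgn_congr; push_cast; grind,
    show sgn (1 * (1 + 1)) = 1 by rw [← sgn_zero]; apply sgn_congr; push_cast; grind,
    one_mul, sgn_one]
  rcases sgn_eq_one_or p with h | h <;> rw [h] <;>
    simp only [smul_add, neg_smul, one_smul, neg_neg, smul_neg] <;> abel

theorem hd_contract_D_left {q q' r : ℤ} {g : Mat N N'} (M : SfMod A) (hg : g ∈ homDeg N N' q)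
    (hq : q + 1 = q') (hr : q - 1 = r) :
    hd (tensor M N) (tensor M N') r (π.contract 1 q M.D g) =
      -π.contract 1 q' M.D (hd N N' q g) +
        (π.contract 1 1 M.D N'.D * tmap 0 q (1 : Mat M M) g -
          tmap 0 q (1 : Mat M M) g * π.contract 1 1 M.D N.D) := by
  subst hq hr
  rw [hd_apply, tensor_D, tensor_D, Matrix.add_mul, Matrix.mul_add,
    π.dm_contract M.D_mem' hg rfl rfl, dm_D, contract_neg_left, contract_hd_right,
    π.contract_mul_right (q := q) M.D_mem' N'.D_mem' (add_comm 1 q),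
    π.contract_mul_right (q := 1) M.D_mem' hg rfl,
    π.contract_mul_left M.D_mem' M.D_mem' hg rfl,
    show sgn (q - 1) = -sgn q by rw [sub_eq_add_neg, ← sgn_mul, sgn_neg_one]; ring,
    show sgn (1 * (q + 1)) = -sgn q by rw [one_mul, ← sgn_mul, sgn_one]; ring,
    one_mul, mul_one, sgn_one]
  rcases sgn_eq_one_or q with h | h <;> rw [h] <;>
    simp only [smul_add, neg_smul, one_smul, neg_neg, smul_neg] <;> abel

/-- The case `f = D_M` of `hd_contract_D_right`: by flatness `hd D_M = D_M D_M`, and the Leibniz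
expansion of this product is the commutator of `t` with `D_M ⊗ 1`, so everything cancels. -/
theorem hd_contract_D_D (M N : SfMod A) :
    hd (tensor M N) (tensor M N) 0 (π.contract 1 1 M.D N.D) = 0 := by
  have h : hd M M 1 M.D = M.D * M.D := by
    rw [hd_apply, dm_D, sgn_one]; simp
  rw [π.hd_contract_D_right (p' := 2) (r := 0) N M.D_mem' rfl rfl, h,
    π.contract_mul_left (r := 2) M.D_mem' M.D_mem' N.D_mem' rfl,
    show sgn (1 * (1 + 1)) = 1 by rw [← sgn_zero]; apply sgn_congr; push_cast; grind, sgn_one]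
  simp only [one_smul, neg_smul]
  abel

/-- Going around the square of `f ⊗ 1` and `1 ⊗ g` in its two orders gives two homotopies for `f ⊗
g`. This coboundary is their difference. -/
theorem hd_contract_closed (f : Z0 M M') (g : Z0 N N') :
    hd (tensor M N) (tensor M' N') (-2) (π.contract 0 0 f.1 g.1) =
      (π.contract 1 0 M'.D g.1 * tmap 0 0 f.1 (1 : Mat N N) -
        tmap 0 0 f.1 (1 : Mat N' N') * π.contract 1 0 M.D g.1) -
      (π.contract 0 1 f.1 N'.D * tmap 0 0 (1 : Mat M M) g.1 -
        tmap 0 0 (1 : Mat M' M') g.1 * π.contract 0 1 f.1 N.D) := by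
  have hf := π.contract_hd_left 0 0 1 f.1 g.1
  have hg := π.contract_hd_right 0 0 1 f.1 g.1
  rw [z0_hd f, contract_zero_left, π.contract_mul_left (r := 1) M'.D_mem' (z0_mem f) (z0_mem g) rfl,
    π.contract_mul_left (r := 1) (z0_mem f) M.D_mem' (z0_mem g) rfl] at hf
  rw [z0_hd g, contract_zero_right, π.contract_mul_right (q := 0) (r := 1) (z0_mem f) N'.D_mem' rfl,
    π.contract_mul_right (q := 1) (r := 1) (z0_mem f) (z0_mem g) rfl] at hg
  rw [hd_apply, tensor_D, tensor_D, Matrix.add_mul, Matrix.mul_add,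
    π.dm_contract (p' := 1) (q' := 1) (z0_mem f) (z0_mem g) rfl rfl,
    show sgn (-2) = 1 by rw [← sgn_zero]; apply sgn_congr; rfl]
  simp only [mul_zero, zero_add, mul_one, sgn_zero, sgn_one, one_smul, neg_smul] at hf hg ⊢
  rw [← sub_eq_zero]
  -- Both `hf` and `hg` have become expansions of `0`. Their difference is substituted for the zero
  -- on the right of the goal.
  have := congrArg₂ (· - ·) hg hf
  simp only [sub_zero] at this
  rw [this]
  abel

end HomDifferential
end ShiftedPoisson

/-! ### Pseudonatural endomorphisms from data on pure tensors. -/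

namespace CochainTwoCat.BiFun
variable {R : Type u} [CommRing R] {C : CochainTwoCat.{u, v, w} R}
    {D : CochainTwoCat.{u, v', w} R} {E : CochainTwoCat.{u, u', x} R} (T : BiFun C D E)

/-- A pseudonatural endomorphism of a functor `C ⊠ D → E` presented by bilinear data. -/
noncomputable def pseudoNat (app : ∀ U V, E.Hom₀ (T.obj U V) (T.obj U V))
    (h : ∀ {U U' V V'}, C.Hom₀ U U' →ₗ[R] D.Hom₀ V V' →ₗ[R] E.Hom₁ (T.obj U V) (T.obj U' V'))
    (nat : ∀ {U U' V V'} (f : C.Hom₀ U U') (g : D.Hom₀ V V'),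
      E.comp (T.b₀ f g) (app U V) - E.comp (app U' V') (T.b₀ f g) = E.δ (h f g))
    (natL : ∀ {U U' V V'} (φ : C.Hom₁ U U') (g : D.Hom₀ V V'),
      E.rwh (app U V) (T.bL φ g) - E.lwh (app U' V') (T.bL φ g) = h (C.δ φ) g)
    (natR : ∀ {U U' V V'} (f : C.Hom₀ U U') (ψ : D.Hom₁ V V'),
      E.rwh (app U V) (T.bR f ψ) - E.lwh (app U' V') (T.bR f ψ) = h f (D.δ ψ))
    (h_one : ∀ U V, h (C.one U) (D.one V) = 0)
    (h_comp : ∀ {U U' U'' V V' V''} (f' : C.Hom₀ U' U'') (g' : D.Hom₀ V' V'')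
      (f : C.Hom₀ U U') (g : D.Hom₀ V V'), h (C.comp f' f) (D.comp g' g) =
        E.rwh (T.b₀ f g) (h f' g') + E.lwh (T.b₀ f' g') (h f g)) :
    PseudoNat T.toFun T.toFun where
  app X := app X.1 X.2
  hmt := TensorProduct.lift h
  naturality {X Y} k := by
    -- The claim is additive in `k`, so pure tensors suffice; it is first spelled out on the
    -- underlying tensor product.
    have : ∀ k : C.Hom₀ X.1 Y.1 ⊗[R] D.Hom₀ X.2 Y.2,
        E.comp (TensorProduct.lift T.b₀ k) (app X.1 X.2) -
          E.comp (app Y.1 Y.2) (TensorProduct.lift T.b₀ k) = E.δ (TensorProduct.lift h k) := by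
      intro k
      induction k using TensorProduct.induction_on with
      | zero => simp
      | add s t hs ht =>
        simp only [map_add, LinearMap.add_apply, ← hs, ← ht]
        abel
      | tmul f g => exact nat f g
    exact this k
  naturality₁ {X Y} q := by
    induction q using boxHom₁_induction with
    | hl φ g =>
      refine Eq.trans ?_ ((natL φ g).trans (congrArg (TensorProduct.lift h) (boxδ_boxL φ g)).symm)
      exact congrArg₂ (· - ·) (congrArg _ (T.map₁_boxL φ g)) (congrArg _ (T.map₁_boxL φ g))
    | hr f ψ =>
      refine Eq.trans ?_ ((natR f ψ).trans (congrArg (TensorProduct.lift h) (boxδ_boxR f ψ)).symm)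
      exact congrArg₂ (· - ·) (congrArg _ (T.map₁_boxR f ψ)) (congrArg _ (T.map₁_boxR f ψ))
    | ha a b ha hb =>
      simp only [map_add, ← ha, ← hb]
      abel
  hmt_one X := h_one X.1 X.2
  hmt_comp {X Y Z} k' k := by
    induction k' using TensorProduct.induction_on with
    | zero => simp
    | add s t hs ht =>
      simp only [map_add, LinearMap.add_apply, hs, ht]
      abel
    | tmul f' g' =>
    induction k using TensorProduct.induction_on with
    | zero => simp
    | add s t hs ht =>
      simp only [map_add, LinearMap.add_apply, hs, ht]
      abel
    | tmul f g => exact h_comp f' g' f g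

end CochainTwoCat.BiFun

/-! ### Equality of 2-cells, and tensoring with identities. -/

namespace SfMod
variable {K : Type u} [Field K] {A : CDGA.{u, v} K} {M M' N N' : SfMod A}

/-- Identities of 2-cells hold only modulo coboundaries; the later lemmas of the form `∃ χ` supply
the witness used here. -/
theorem H1.mk_eq_of_hd {φ ψ : homDeg M N (-1)} {χ : Mat M N} (hχ : χ ∈ homDeg M N (-2))
    (h : SfMod.hd M N (-2) χ = φ.1 - ψ.1) : H1.mk φ = H1.mk ψ :=
  (Submodule.Quotient.eq _).mpr ⟨χ, hχ, h⟩

/-- The identity 1-cell. -/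
def oneZ (M : SfMod A) : Z0 M M := ⟨1, one_mem M, hd_one M⟩

theorem hd_one_tmap {q r : ℤ} {g : Mat N N'} (M : SfMod A) (hg : g ∈ homDeg N N' q)
    (hr : q + 1 = r) :
    hd (tensor M N) (tensor M N') q (tmap 0 q (1 : Mat M M) g) =
      tmap 0 r (1 : Mat M M) (hd N N' q g) := by
  rw [hd_tmap 0 q 1 r q M.one_mem hg rfl hr (zero_add q), hd_one, sgn_zero, one_smul, map_zero,
    LinearMap.zero_apply, zero_add]

theorem hd_tmap_one {p r : ℤ} {f : Mat M M'} (N : SfMod A) (hf : f ∈ homDeg M M' p)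
    (hr : p + 1 = r) :
    hd (tensor M N) (tensor M' N) p (tmap p 0 f (1 : Mat N N)) =
      tmap r 0 (hd M M' p f) (1 : Mat N N) := by
  rw [hd_tmap p 0 r 1 p hf N.one_mem hr rfl (add_zero p), hd_one, map_zero, smul_zero, add_zero]

/-- In this order `g` passes `f` at the cost of `(-1)^{q p}`, which `h` makes trivial. The opposite
order, in the next lemma, costs no sign. -/
theorem one_tmap_mul_tmap_one {p q : ℤ} {f : Mat M M'} {g : Mat N N'} (hf : f ∈ homDeg M M' p)
    (hg : g ∈ homDeg N N' q) (h : q * p = 0) :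
    tmap 0 q (1 : Mat M' M') g * tmap p 0 f (1 : Mat N N) = tmap p q f g := by
  rw [tmap_mul p 0 0 q hg hf, h, sgn_zero, one_smul, zero_add, add_zero, Matrix.one_mul,
    Matrix.mul_one]

theorem tmap_one_mul_one_tmap (p q : ℤ) {f : Mat M M'} {g : Mat N N'} :
    tmap p 0 f (1 : Mat N' N') * tmap 0 q (1 : Mat M M) g = tmap p q f g := by
  rw [tmap_mul 0 q p 0 N'.one_mem M.one_mem, mul_zero, sgn_zero, one_smul, zero_add, add_zero,
    Matrix.one_mul, Matrix.mul_one]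

end SfMod

namespace ShiftedPoisson
variable {K : Type u} [Field K] {A : CDGA.{u, v} K}

open SfMod

/-! ### The homotopy `t_{f ⊠ g}`: naturality, 2-cells and composition. -/

section Homotopy
variable (π : ShiftedPoisson A 2) {M M' M'' N N' N'' : SfMod A}

theorem homotopyMat_mem {f : Mat M M'} {g : Mat N N'} (hf : f ∈ homDeg M M' 0)
    (hg : g ∈ homDeg N N' 0) :
    π.homotopyMat f g ∈ homDeg (tensor M N) (tensor M' N') (-1) :=
  sub_mem (neg_mem (mul_mem (q := 0) (p := -1) (tmap_mem M'.one_mem hg rfl)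
    (π.contract_mem hf N.D_mem' rfl) rfl))
    (mul_mem (q := -1) (p := 0) (π.contract_mem M'.D_mem' hg rfl)
      (tmap_mem hf N.one_mem rfl) rfl)

/-- The homotopy as an element of degree `-1`. -/
def homotopyHom (f : Z0 M M') (g : Z0 N N') : homDeg (tensor M N) (tensor M' N') (-1) :=
  ⟨π.homotopyMat f.1 g.1, π.homotopyMat_mem (z0_mem f) (z0_mem g)⟩

theorem homotopyMat_eq (f : Mat M M') (g : Mat N N') : π.homotopyMat f g =
    -(tmap 0 0 (1 : Mat M' M') g * π.contract 0 1 f N.D) -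
      π.contract 1 0 M'.D g * tmap 0 0 f (1 : Mat N N) := rfl

/-- The class of the homotopy, as a bilinear map. -/
def homotopyₗ (M M' N N' : SfMod A) :
    Z0 M M' →ₗ[K] Z0 N N' →ₗ[K] H1 (tensor M N) (tensor M' N') :=
  LinearMap.mk₂ K (fun f g => H1.mk (π.homotopyHom f g))
    (fun f f' g => H1.mk_eq (ψ := π.homotopyHom f g + π.homotopyHom f' g) (by
      change π.homotopyMat (f.1 + f'.1) g.1 = π.homotopyMat f.1 g.1 + π.homotopyMat f'.1 g.1
      simp only [homotopyMat_eq, ← contractₗ_apply, map_add, LinearMap.add_apply, Matrix.mul_add]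
      abel))
    (fun c f g => H1.mk_eq (ψ := c • π.homotopyHom f g) (by
      change π.homotopyMat (c • f.1) g.1 = c • π.homotopyMat f.1 g.1
      simp only [homotopyMat_eq, ← contractₗ_apply, map_smul, LinearMap.smul_apply,
        Matrix.mul_smul, smul_sub, smul_neg]))
    (fun f g g' => H1.mk_eq (ψ := π.homotopyHom f g + π.homotopyHom f g') (by
      change π.homotopyMat f.1 (g.1 + g'.1) = π.homotopyMat f.1 g.1 + π.homotopyMat f.1 g'.1
      simp only [homotopyMat_eq, ← contractₗ_apply, map_add, Matrix.add_mul]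
      abel))
    (fun c f g => H1.mk_eq (ψ := c • π.homotopyHom f g) (by
      change π.homotopyMat f.1 (c • g.1) = c • π.homotopyMat f.1 g.1
      simp only [homotopyMat_eq, ← contractₗ_apply, map_smul,
        Matrix.smul_mul, smul_sub, smul_neg]))

/-- For closed `f` the term with `hd f` drops out, so `∇f` paired with `∇D_N` is a homotopy for
naturality of `t` in the first variable. -/
theorem hd_contract_left_closed (f : Z0 M M') (N : SfMod A) :
    hd (tensor M N) (tensor M' N) (-1) (π.contract 0 1 f.1 N.D) =
      π.contract 1 1 M'.D N.D * tmap 0 0 f.1 (1 : Mat N N) -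
        tmap 0 0 f.1 (1 : Mat N N) * π.contract 1 1 M.D N.D := by
  rw [π.hd_contract_D_right (p' := 1) (r := -1) N (z0_mem f) rfl rfl, z0_hd f, contract_zero_left, neg_zero,
    zero_add]

theorem hd_contract_right_closed (M : SfMod A) (g : Z0 N N') :
    hd (tensor M N) (tensor M N') (-1) (π.contract 1 0 M.D g.1) =
      π.contract 1 1 M.D N'.D * tmap 0 0 (1 : Mat M M) g.1 -
        tmap 0 0 (1 : Mat M M) g.1 * π.contract 1 1 M.D N.D := by
  rw [π.hd_contract_D_left (q' := 1) (r := -1) M (z0_mem g) rfl rfl, z0_hd g, contract_zero_right, neg_zero,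
    zero_add]

/-- For a chain map `X`, `X ∘ -` commutes with the differential. -/
theorem hd_closed_mul {P Q R : SfMod A} {r : ℤ} {X : Mat Q R} (hX : X ∈ homDeg Q R 0)
    (hX' : hd Q R 0 X = 0) (Y : Mat P Q) : hd P R r (X * Y) = X * hd P Q r Y := by
  rw [hd_mul (p := r) hX (zero_add r), hX', sgn_zero, one_smul, Matrix.zero_mul, zero_add]

/-- For a chain map `X`, `- ∘ X` commutes with the differential. -/
theorem hd_mul_closed {P Q R : SfMod A} {r : ℤ} {X : Mat P Q}
    (hX' : hd P Q 0 X = 0) {Y : Mat Q R} (hY : Y ∈ homDeg Q R r) :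
    hd P R r (Y * X) = hd Q R r Y * X := by
  rw [hd_mul (p := 0) hY (add_zero r), hX', Matrix.mul_zero, smul_zero, add_zero]

theorem one_tmap_closed (M : SfMod A) (g : Z0 N N') :
    hd (tensor M N) (tensor M N') 0 (tmap 0 0 (1 : Mat M M) g.1) = 0 := by
  rw [hd_one_tmap M (z0_mem g) (zero_add 1), z0_hd g, map_zero]

theorem tmap_one_closed (f : Z0 M M') (N : SfMod A) :
    hd (tensor M N) (tensor M' N) 0 (tmap 0 0 f.1 (1 : Mat N N)) = 0 := by
  rw [hd_tmap_one N (z0_mem f) (zero_add 1), z0_hd f, map_zero, LinearMap.zero_apply]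

/-- The one-variable homotopies are pasted along `f ⊗ g = (1 ⊗ g) (f ⊗ 1)`; the intermediate terms
`(1 ⊗ g) t (f ⊗ 1)` cancel. -/
theorem hd_homotopyMat (f : Z0 M M') (g : Z0 N N') :
    hd (tensor M N) (tensor M' N') (-1) (π.homotopyMat f.1 g.1) =
      tmap 0 0 f.1 g.1 * π.contract 1 1 M.D N.D - π.contract 1 1 M'.D N'.D * tmap 0 0 f.1 g.1 := by
  rw [homotopyMat_eq, map_sub, map_neg,
    hd_closed_mul (tmap_mem M'.one_mem (z0_mem g) rfl) (one_tmap_closed M' g),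
    hd_mul_closed (tmap_one_closed f N) (π.contract_mem (r := -1) M'.D_mem' (z0_mem g) rfl),
    hd_contract_left_closed, hd_contract_right_closed,
    ← one_tmap_mul_tmap_one (z0_mem f) (z0_mem g) rfl]
  simp only [Matrix.mul_sub, Matrix.sub_mul, Matrix.mul_assoc]
  abel

theorem homotopy_hd_left (φ : homDeg M M' (-1)) (g : Z0 N N') :
    ∃ χ ∈ homDeg (tensor M N) (tensor M' N') (-2), hd (tensor M N) (tensor M' N') (-2) χ =
      tmap (-1) 0 φ.1 g.1 * π.contract 1 1 M.D N.D -
        π.contract 1 1 M'.D N'.D * tmap (-1) 0 φ.1 g.1 -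
          π.homotopyMat (hd M M' (-1) φ.1) g.1 := by
  have m1 := tmap_mem (r := 0) M'.one_mem (z0_mem g) rfl
  have m2 := π.contract_mem (r := -2) φ.2 N.D_mem' rfl
  have m3 := π.contract_mem (r := -1) M'.D_mem' (z0_mem g) rfl
  have m4 := tmap_mem (r := -1) φ.2 N.one_mem rfl
  -- The witness is the formula for `homotopyMat` with `f` replaced by `φ`, one degree lower.
  refine ⟨-(tmap 0 0 (1 : Mat M' M') g.1 * π.contract (-1) 1 φ.1 N.D) -
    π.contract 1 0 M'.D g.1 * tmap (-1) 0 φ.1 (1 : Mat N N),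
    sub_mem (neg_mem (mul_mem m1 m2 rfl)) (mul_mem m3 m4 rfl), ?_⟩
  rw [map_sub, map_neg, hd_closed_mul m1 (one_tmap_closed M' g),
    π.hd_contract_D_right (p' := 0) (r := -2) N φ.2 rfl rfl,
    hd_mul (p := -1) (r := -2) m3 rfl, hd_contract_right_closed, hd_tmap_one N φ.2 (neg_add_cancel 1),
    sgn_neg_one, homotopyMat_eq, ← one_tmap_mul_tmap_one φ.2 (z0_mem g) rfl]
  simp only [Matrix.mul_sub, Matrix.sub_mul, Matrix.mul_add, Matrix.mul_neg, Matrix.mul_assoc,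
    neg_smul, one_smul]
  abel

theorem homotopy_hd_right (f : Z0 M M') (ψ : homDeg N N' (-1)) :
    ∃ χ ∈ homDeg (tensor M N) (tensor M' N') (-2), hd (tensor M N) (tensor M' N') (-2) χ =
      tmap 0 (-1) f.1 ψ.1 * π.contract 1 1 M.D N.D -
        π.contract 1 1 M'.D N'.D * tmap 0 (-1) f.1 ψ.1 -
          π.homotopyMat f.1 (hd N N' (-1) ψ.1) := by
  have m1 := tmap_mem (r := -1) M'.one_mem ψ.2 rfl
  have m2 := π.contract_mem (r := -1) (z0_mem f) N.D_mem' rfl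
  have m3 := π.contract_mem (r := -2) M'.D_mem' ψ.2 rfl
  have m4 := tmap_mem (r := 0) (z0_mem f) N.one_mem rfl
  -- Compared with `homotopyMat`, the first summand changes sign: the hom differential reaches the
  -- odd factor `1 ⊗ ψ` before the contraction.
  refine ⟨tmap 0 (-1) (1 : Mat M' M') ψ.1 * π.contract 0 1 f.1 N.D -
    π.contract 1 (-1) M'.D ψ.1 * tmap 0 0 f.1 (1 : Mat N N),
    sub_mem (mul_mem m1 m2 rfl) (mul_mem m3 m4 rfl), ?_⟩
  rw [map_sub, hd_mul (p := -1) (r := -2) m1 rfl, hd_contract_left_closed,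
    hd_mul_closed (tmap_one_closed f N) m3, π.hd_contract_D_left (q' := 0) (r := -2) M' ψ.2 rfl rfl,
    hd_one_tmap M' ψ.2 (neg_add_cancel 1),
    sgn_neg_one, homotopyMat_eq, ← one_tmap_mul_tmap_one (z0_mem f) ψ.2 rfl]
  simp only [Matrix.mul_sub, Matrix.sub_mul, Matrix.add_mul, Matrix.neg_mul, Matrix.mul_assoc,
    neg_smul, one_smul]
  abel

/-- Pasting the homotopies of `(f, g)` and `(f', g')` moves `f, g, f', g'` in this order, while the
homotopy of the composites moves `f, f', g, g'`. Exchanging `f'` and `g` in the middle is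
`hd_contract_closed`, whiskered by `f ⊗ 1` and `1 ⊗ g'`. -/
theorem homotopyMat_comp (f' : Z0 M' M'') (g' : Z0 N' N'') (f : Z0 M M') (g : Z0 N N') :
    ∃ χ ∈ homDeg (tensor M N) (tensor M'' N'') (-2), hd (tensor M N) (tensor M'' N'') (-2) χ =
      π.homotopyMat (f'.1 * f.1) (g'.1 * g.1) -
        (π.homotopyMat f'.1 g'.1 * tmap 0 0 f.1 g.1 +
          tmap 0 0 f'.1 g'.1 * π.homotopyMat f.1 g.1) := by
  have m1 := tmap_mem (r := 0) M''.one_mem (z0_mem g') rfl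
  have m2 := π.contract_mem (r := -2) (z0_mem f') (z0_mem g) rfl
  have m3 := tmap_mem (r := 0) (z0_mem f) N.one_mem rfl
  refine ⟨-(tmap 0 0 (1 : Mat M'' M'') g'.1 *
    (π.contract 0 0 f'.1 g.1 * tmap 0 0 f.1 (1 : Mat N N))),
    neg_mem (mul_mem m1 (mul_mem m2 m3 rfl) rfl), ?_⟩
  have t1 : tmap 0 0 (1 : Mat M'' M'') (g'.1 * g.1) = tmap 0 0 (1 : Mat M'' M'') g'.1 *
      tmap 0 0 (1 : Mat M'' M'') g.1 := by
    rw [tmap_mul 0 0 0 0 (z0_mem g') M''.one_mem, mul_zero, sgn_zero, one_smul, Matrix.one_mul]; rfl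
  have t2 : tmap 0 0 (f'.1 * f.1) (1 : Mat N N) = tmap 0 0 f'.1 (1 : Mat N N) *
      tmap 0 0 f.1 (1 : Mat N N) := by
    rw [tmap_mul 0 0 0 0 N.one_mem (z0_mem f), mul_zero, sgn_zero, one_smul, Matrix.one_mul]; rfl
  have s1 := one_tmap_mul_tmap_one (z0_mem f') (z0_mem g') rfl
  have s2 := one_tmap_mul_tmap_one (z0_mem f) (z0_mem g) rfl
  rw [map_neg, hd_closed_mul m1 (one_tmap_closed M'' g'), hd_mul_closed (tmap_one_closed f N) m2,
    hd_contract_closed, homotopyMat_eq, homotopyMat_eq, homotopyMat_eq, t1, t2,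
    π.contract_mul_left (z0_mem f') (z0_mem f) N.D_mem' (add_zero 0),
    π.contract_mul_right (q := 0) M''.D_mem' (z0_mem g') (add_zero 0)]
  -- The interchange law for `f'` and `g`, stated with a trailing factor so that it applies to
  -- right-nested products.
  have c : ∀ Z : Mat (tensor M N) (tensor M' N), tmap 0 0 f'.1 (1 : Mat N' N') *
      (tmap 0 0 (1 : Mat M' M') g.1 * Z) = tmap 0 0 (1 : Mat M'' M'') g.1 *
        (tmap 0 0 f'.1 (1 : Mat N N) * Z) := fun Z => by
    rw [← Matrix.mul_assoc, ← Matrix.mul_assoc, tmap_one_mul_one_tmap,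
      one_tmap_mul_tmap_one (z0_mem f') (z0_mem g) rfl]
  simp only [zero_mul, sgn_zero, one_smul, Matrix.mul_sub, Matrix.sub_mul, Matrix.mul_add,
    Matrix.add_mul, Matrix.mul_neg, Matrix.neg_mul, ← s1, ← s2, Matrix.mul_assoc, c]
  abel

end Homotopy
end ShiftedPoisson

namespace ShiftedPoisson
variable {K : Type u} [Field K] {A : CDGA.{u, v} K}

open SfMod

/-! ### Construction of the induced braiding, and symmetry. -/

section Braiding
variable (π : ShiftedPoisson A 2) {M M' M'' N N' N'' : SfMod A}

/-- Each summand of `homotopyMat` differentiates `f` or `g`, and here both have constant entries. -/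
theorem homotopyMat_pm (σ : M.ι ≃ M'.ι) (c : M.ι → ℤ) (τ : N.ι ≃ N'.ι) (c' : N.ι → ℤ) :
    π.homotopyMat (pm M M' σ c) (pm N N' τ c') = 0 := by
  rw [homotopyMat_eq, contract_pm_left, contract_pm_right, Matrix.mul_zero, Matrix.zero_mul,
    neg_zero, sub_zero]

/-- Conjugation by `γ` turns "`f` first, then `g`" into the order opposite to the one used for `g ⊠
f`. The discrepancy is again `hd_contract_closed`, now for the pair `(g, f)`. -/
theorem homotopyMat_symm (f : Z0 M M') (g : Z0 N N') :
    ∃ χ ∈ homDeg (tensor M N) (tensor N' M') (-2), hd (tensor M N) (tensor N' M') (-2) χ =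
      γm M' N' * π.homotopyMat f.1 g.1 - π.homotopyMat g.1 f.1 * γm M N := by
  have mγ : γm M N ∈ homDeg (tensor M N) (tensor N M) 0 := z0_mem (γZ M N)
  have hγ : hd (tensor M N) (tensor N M) 0 (γm M N) = 0 := z0_hd (γZ M N)
  have m := π.contract_mem (r := -2) (z0_mem g) (z0_mem f) rfl
  refine ⟨π.contract 0 0 g.1 f.1 * γm M N, mul_mem m mγ rfl, ?_⟩
  have n1 := γm_nat 0 0 M'.one_mem (z0_mem g)
  have n2 := γm_nat 0 0 (z0_mem f) N.one_mem
  have k1 := π.γm_contract (z0_mem f) N.D_mem'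
  have k2 := π.γm_contract M'.D_mem' (z0_mem g)
  have e : sgn ((0 + 1) * (1 + 1)) = 1 := by rw [← sgn_zero]; apply sgn_congr; rfl
  have e' : sgn ((1 + 1) * (0 + 1)) = 1 := by rw [← sgn_zero]; apply sgn_congr; rfl
  rw [mul_zero, sgn_zero, one_smul] at n1 n2
  rw [e, one_smul] at k1
  rw [e', one_smul] at k2
  rw [hd_mul_closed hγ m, hd_contract_closed, homotopyMat_eq, homotopyMat_eq,
    Matrix.mul_sub, Matrix.mul_neg, ← Matrix.mul_assoc, ← Matrix.mul_assoc, n1, k2,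
    Matrix.mul_assoc, Matrix.mul_assoc, n2, k1]
  simp only [Matrix.sub_mul, Matrix.neg_mul, Matrix.mul_assoc]
  abel

theorem homotopyHom_symm (f : Z0 M M') (g : Z0 N N') :
    lwh _ _ _ (γZ M' N') (H1.mk (π.homotopyHom f g)) =
      rwh _ _ _ (γZ M N) (H1.mk (π.homotopyHom g f)) := by
  obtain ⟨χ, hχ, h⟩ := π.homotopyMat_symm f g
  exact H1.mk_eq_of_hd
    (φ := ⟨γm M' N' * π.homotopyMat f.1 g.1,
      mul_mem (z0_mem (γZ M' N')) (π.homotopyHom f g).2 rfl⟩)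
    (ψ := ⟨π.homotopyMat g.1 f.1 * γm M N,
      mul_mem (π.homotopyHom g f).2 (z0_mem (γZ M N)) rfl⟩) hχ h

theorem contract_D_D_symm (M N : SfMod A) :
    γm M N * π.contract 1 1 M.D N.D = π.contract 1 1 N.D M.D * γm M N := by
  rw [π.γm_contract M.D_mem' N.D_mem',
    show sgn ((1 + 1) * (1 + 1)) = 1 by rw [← sgn_zero]; apply sgn_congr; rfl, one_smul]

/-- The cochain component of the induced infinitesimal 2-braiding. -/
def contractZ (M N : SfMod A) : Z0 (tensor M N) (tensor M N) :=
  ⟨π.contract 1 1 M.D N.D, π.contract_mem M.D_mem' N.D_mem' rfl, π.hd_contract_D_D M N⟩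

/-- The infinitesimal 2-braiding induced by a 2-shifted Poisson structure. -/
noncomputable def infBraiding : CochainTwoCat.InfBraiding (symMon A) :=
  (tensorBi A).pseudoNat π.contractZ (fun {M M' N N'} => π.homotopyₗ M M' N N')
    (fun f g => Subtype.ext (π.hd_homotopyMat f g).symm)
    (fun {M M' N N'} φ g => by
      induction φ using H1.ind with
      | h φ =>
      obtain ⟨χ, hχ, h⟩ := π.homotopy_hd_left φ g
      -- Explicit representatives of the two whiskered 2-cells are given, so that `h` is literally
      -- the required coboundary equation.
      exact H1.mk_eq_of_hd (φ :=
        ⟨tmap (-1) 0 φ.1 g.1 * π.contract 1 1 M.D N.D,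
          mul_mem (tmap_mem φ.2 (z0_mem g) rfl) (z0_mem (π.contractZ M N)) rfl⟩ -
        ⟨π.contract 1 1 M'.D N'.D * tmap (-1) 0 φ.1 g.1,
          mul_mem (z0_mem (π.contractZ M' N')) (tmap_mem φ.2 (z0_mem g) rfl) rfl⟩)
        (ψ := π.homotopyHom (δ M M' (H1.mk φ)) g) hχ h)
    (fun {M M' N N'} f ψ => by
      induction ψ using H1.ind with
      | h ψ =>
      obtain ⟨χ, hχ, h⟩ := π.homotopy_hd_right f ψ
      exact H1.mk_eq_of_hd (φ :=
        ⟨tmap 0 (-1) f.1 ψ.1 * π.contract 1 1 M.D N.D,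
          mul_mem (tmap_mem (z0_mem f) ψ.2 rfl) (z0_mem (π.contractZ M N)) rfl⟩ -
        ⟨π.contract 1 1 M'.D N'.D * tmap 0 (-1) f.1 ψ.1,
          mul_mem (z0_mem (π.contractZ M' N')) (tmap_mem (z0_mem f) ψ.2 rfl) rfl⟩)
        (ψ := π.homotopyHom f (δ N N' (H1.mk ψ))) hχ h)
    (fun M N => (H1.mk_eq (ψ := 0) (by
      change π.homotopyMat (1 : Mat M M) (1 : Mat N N) = 0
      -- Identity matrices are permutation matrices with trivial signs, hence constant.
      rw [← pm_one, ← pm_one, homotopyMat_pm])).trans (Submodule.Quotient.mk_zero _))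
    (fun {M M' M'' N N' N''} f' g' f g => by
      obtain ⟨χ, hχ, h⟩ := π.homotopyMat_comp f' g' f g
      exact H1.mk_eq_of_hd (φ := π.homotopyHom (comp M M' M'' f' f) (comp N N' N'' g' g))
        (ψ := (⟨π.homotopyMat f'.1 g'.1 * tmap 0 0 f.1 g.1,
            mul_mem (π.homotopyHom f' g').2 (tmap_mem (z0_mem f) (z0_mem g) rfl) rfl⟩ :
              homDeg (tensor M N) (tensor M'' N'') (-1)) +
          (⟨tmap 0 0 f'.1 g'.1 * π.homotopyMat f.1 g.1,
            mul_mem (tmap_mem (z0_mem f') (z0_mem g') rfl) (π.homotopyHom f g).2 rfl⟩ :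
              homDeg (tensor M N) (tensor M'' N'') (-1))) hχ h)

theorem induces_infBraiding : π.Induces π.infBraiding where
  cochain_eq _ _ := rfl
  homotopy_eq f g := ⟨π.homotopyHom f g, rfl, rfl⟩

/-! ### Properties of an arbitrary braiding induced by `π`. -/

variable {π} {t : CochainTwoCat.InfBraiding (symMon A)}

/-- The representative is prescribed as a matrix, so its class does not depend on `t`; this reduces
every induced braiding to the explicit formulas. -/
theorem Induces.homotopy_eq_mk (ht : π.Induces t) (f : Z0 M M') (g : Z0 N N') :
    t.homotopy f g = H1.mk (π.homotopyHom f g) := by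
  obtain ⟨φ, hφ, h⟩ := ht.homotopy_eq f g
  exact h.trans (H1.mk_eq hφ)

theorem Induces.homotopy_eq_zero (ht : π.Induces t) (f : Z0 M M') (g : Z0 N N')
    (h : π.homotopyMat f.1 g.1 = 0) :
    t.homotopy f g = (0 : H1 (tensor M N) (tensor M' N')) :=
  (ht.homotopy_eq_mk f g).trans ((H1.mk_eq (ψ := 0) h).trans (Submodule.Quotient.mk_zero _))

theorem Induces.homotopy_γ_one (ht : π.Induces t) (M N P : SfMod A) :
    t.homotopy ((symMon A).γ M N) ((symMon A).cat.one P) = 0 :=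
  ht.homotopy_eq_zero (γZ M N) (oneZ P) (by
    change π.homotopyMat (γm M N) (1 : Mat P P) = 0
    rw [← pm_one]; exact π.homotopyMat_pm _ _ _ _)

theorem Induces.homotopy_one_γ (ht : π.Induces t) (M N P : SfMod A) :
    t.homotopy ((symMon A).cat.one M) ((symMon A).γ N P) = 0 :=
  ht.homotopy_eq_zero (oneZ M) (γZ N P) (by
    change π.homotopyMat (1 : Mat M M) (γm N P) = 0
    rw [← pm_one]; exact π.homotopyMat_pm _ _ _ _)

theorem Induces.cochain_eq_contractZ (ht : π.Induces t) (M N : SfMod A) :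
    t.cochain M N = π.contractZ M N :=
  Subtype.ext (ht.cochain_eq M N)

theorem Induces.isTotallySymmetric (ht : π.Induces t) : t.IsTotallySymmetric where
  cochain_eq M N :=
    (congrArg _ (ht.cochain_eq_contractZ M N)).trans
      ((Subtype.ext (π.contract_D_D_symm M N) : comp _ _ _ (γZ M N) (π.contractZ M N) =
          comp _ _ _ (π.contractZ N M) (γZ M N)).trans
        (congrArg (fun x => (symMon A).cat.comp x ((symMon A).γ M N))
          (ht.cochain_eq_contractZ N M)).symm)
  homotopy_eq f g :=
    (congrArg _ (ht.homotopy_eq_mk f g)).trans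
      ((π.homotopyHom_symm f g).trans (congrArg _ (ht.homotopy_eq_mk g f)).symm)
  homotopy_γ := ht.homotopy_γ_one

/-- The two summands vanish separately, since `t_{1 ⊠ γ}` and `t_{γ ⊠ 1}` are both zero; no
cancellation between them is needed. -/
theorem Induces.isBreen (ht : π.Induces t) : t.IsBreen := fun M N P => by
  have h₁ := ht.homotopy_one_γ M N P
  have h₂ := ht.homotopy_γ_one M N P
  refine (congrArg₂ (fun x y => (symMon A).cat.rwh ((symMon A).α M N P)
      ((symMon A).cat.lwh ((symMon A).γ M ((symMon A).tensor.tObj P N)) x) +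
    (symMon A).cat.lwh ((symMon A).αinv P N M)
      ((symMon A).cat.lwh ((symMon A).γ ((symMon A).tensor.tObj N M) P) y)) h₁ h₂).trans ?_
  simp only [map_zero, add_zero]

end Braiding
end ShiftedPoisson

theorem mainTheorem9 {K : Type*} [Field K] [CharZero K] (A : CDGA K) (hA : A.IsSemiFree)
    (π : ShiftedPoisson A 2) :
    (∃ t : CochainTwoCat.InfBraiding (SfMod.symMon A), π.Induces t) ∧
      ∀ t : CochainTwoCat.InfBraiding (SfMod.symMon A), π.Induces t →
        t.IsTotallySymmetric ∧ t.IsBreen :=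
  ⟨⟨π.infBraiding, π.induces_infBraiding⟩, fun _ ht => ⟨ht.isTotallySymmetric, ht.isBreen⟩⟩
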